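/- **Crystals.** A crystal description is $\mathbf M=(\mathbf A,\mathbf P,\mathbf L)$ with feature vectors $\mathbf A=[a_1,\dots,a_n]\in\mathbb R^{d\times n}$, positions $\mathbf P=[p_1,\dots,p_n]\in\mathbb R^{3\times n}$, $n\ge 1$, and linearly independent lattice vectors $\mathbf L=[\ell_1,\ell_2,\ell_3]$; the $p_i$ are pairwise distinct modulo the lattice $\mathbb Z\ell_1+\mathbb Z\ell_2+\mathbb Z\ell_3$. Its infinite structure is the set of all pairs $(p_i+k_1\ell_1+k_2\ell_2+k_3\ell_3,\ a_i)$ with $k\in\mathbb Z^3$, $1\le i\le n$. $\mathbf M$ is a *minimum* representation if no description of the same infinite structure has smaller cell volume. The atomic number $Z_i=Z(a_i)\in\mathbb N$ is a function of the feature vector. A map $f$ on crystal descriptions is *periodic invariant* if $f(\mathbf M)=f(\mathbf M')$ for all minimum representations $\mathbf M,\mathbf M'$ of the same infinite structure, and *unit cell $SE(3)$ invariant* if $f(\mathbf A,\mathbf P,\mathbf L)=f(\mathbf A,\mathbf R\mathbf P+b,\mathbf R\mathbf L)$ for all $\mathbf R\in SO(3)$, $b\in\mathbb R^3$. **Unit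 cell.** Fix a radius $r\in\mathbb R$. A *choice* for $\mathbf M$ consists of a right-handed Niggli-reduced basis $\mathbf L_u=[\ell_1',\ell_2',\ell_3']$ of the lattice of $\mathbf M$ and an origin atom $o$ for which $(Z_i,\rho_{i,r},\rho^{\ell_1'}_{i,r},\rho^{\ell_2'}_{i,r},\rho^{\ell_3'}_{i,r})$ is lexicographically smallest among the atoms $i$ of the cell. Here $\rho_{i,r}$ is the sum of the atomic numbers of the atoms of the infinite structure, other than $i$ itself, within distance $r$ of $p_i$, and $\rho^{\ell_k'}_{i,r}$ is the same sum over those whose $k$-th fractional coordinate with respect to $\mathbf L_u$ exceeds that of $i$. The resulting unit cell is $(\mathbf A_u,\mathbf P_u,\mathbf L_u)$, where atom $j$ has fractional coordinates $(p_{\mathrm{frac},j}-p_{\mathrm{frac},o})\bmod 1$, and $\mathbf P_u$ is obtained from these coordinates and $\mathbf L_u$. Unit cells are considered up to the numbering of their atoms. **Sequence.** The sequence of a choice lists: the number of atoms in the cell and the number of atoms of each atomic number; the space group type (the class of the group of all isometries of $\mathbb R^3$ preserving the infinite structure, under conjugation by orientation-preserving affine maps) and the set of space group transformations in fractional coordinates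 of the unit cell, with translation parts mod 1; the lattice parameters $a,b,c,\alpha,\beta,\gamma$ of $\mathbf L_u$; and $[Z_i,x_i,y_i,z_i]$ (atomic number and fractional coordinates) for the irreducible atoms $i$, that is, the atom with lexicographically smallest fractional coordinates in each symmetry class, ordered by atomic number, size of the class, and fractional coordinates. A sequence is *admissible* for $\mathbf M$ if it is the sequence of some choice for $\mathbf M$. *Mat2Seq* sends $\mathbf M$ to its admissible sequence; if there are several, one is selected by a fixed but arbitrary rule that depends only on the set of admissible sequences. **Lemma.** For every $d$, every $Z:\mathbb R^d\to\mathbb N$ and every $r\in\mathbb R$: 1. every crystal description has at least one choice; 2. the set of unit cells $(\mathbf A_u,\mathbf P_u,\mathbf L_u)$ of choices is periodic invariant, and for all $\mathbf R\in SO(3)$, $b\in\mathbb R^3$ the set belonging to $(\mathbf A,\mathbf R\mathbf P+b,\mathbf R\mathbf L)$ consists exactly of the cells $(\mathbf A_u,\mathbf R\mathbf P_u,\mathbf R\mathbf L_u)$; 3. Mat2Seq is periodic invariant and unit cell $SE(3)$ invariant; 4. if $f$ is any map sending each crystal description to one of its admissible sequences, and $\mathbf M=(\mathbf A,\mathbf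 P,\mathbf L)$ has only one admissible sequence, then $f(\mathbf M)=f(\mathbf A,\mathbf R\mathbf P+b,\mathbf R\mathbf L)$ for all $\mathbf R\in SO(3)$, $b\in\mathbb R^3$, and, if $\mathbf M$ is minimum, $f(\mathbf M)=f(\mathbf M')$ for every minimum representation $\mathbf M'$ of the same infinite structure. -/

import Mathlib

noncomputable section

namespace Mat2Seq

/-- Euclidean three-space. -/
abbrev E3 := EuclideanSpace ℝ (Fin 3)

/-- Atom feature vectors of dimension `d`. -/
abbrev Feature (d : ℕ) := Fin d → ℝ

/-- The `3 × 3` matrix whose columns are the three given vectors. -/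
def cellMatrix (B : Fin 3 → E3) : Matrix (Fin 3) (Fin 3) ℝ :=
  Matrix.of fun i k => B k i

/-- The lattice spanned by three vectors. -/
def lattice (B : Fin 3 → E3) : Submodule ℤ E3 :=
  Submodule.span ℤ (Set.range B)

/-- A description `(A, P, L)` of a crystal with `n ≥ 1` atoms per cell: feature vectors, positions,
and three linearly independent lattice vectors. No two atoms occupy the same place of the
infinite structure. -/
structure Crystal (d : ℕ) where
  n : ℕ
  A : Fin n → Feature d
  P : Fin n → E3
  L : Fin 3 → E3
  n_pos : 0 < n
  linInd : LinearIndependent ℝ L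
  distinct : ∀ i j, P i - P j ∈ lattice L → i = j

/-- A rotation matrix acting on space. -/
def rot (R : Matrix.specialOrthogonalGroup (Fin 3) ℝ) : E3 →ₗ[ℝ] E3 :=
  Matrix.toEuclideanLin (R : Matrix (Fin 3) (Fin 3) ℝ)

theorem rot_injective (R : Matrix.specialOrthogonalGroup (Fin 3) ℝ) :
    Function.Injective (rot R) := by
  intro x y h
  have h1 := R.2
  rw [Matrix.mem_specialOrthogonalGroup_iff, Matrix.mem_orthogonalGroup_iff'] at h1
  have h2 : (R : Matrix (Fin 3) (Fin 3) ℝ).mulVec x.ofLp =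
      (R : Matrix (Fin 3) (Fin 3) ℝ).mulVec y.ofLp := by
    have h3 := congrArg WithLp.ofLp h
    exact h3
  have h4 := congrArg (Matrix.mulVec (Matrix.transpose (R : Matrix (Fin 3) (Fin 3) ℝ))) h2
  rw [Matrix.mulVec_mulVec, Matrix.mulVec_mulVec, h1.1, Matrix.one_mulVec,
    Matrix.one_mulVec] at h4
  exact WithLp.ofLp_injective 2 h4

theorem mem_lattice_rot (R : Matrix.specialOrthogonalGroup (Fin 3) ℝ) (L : Fin 3 → E3) (x : E3)
    (h : rot R x ∈ lattice (fun k => rot R (L k))) : x ∈ lattice L := by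
  have h1 : lattice (fun k => rot R (L k)) =
      (lattice L).map ((rot R).restrictScalars ℤ) := by
    unfold lattice
    rw [Submodule.map_span]
    congr 1
    ext y
    simp
  rw [h1] at h
  obtain ⟨y, hy, hxy⟩ := Submodule.mem_map.1 h
  have h2 : y = x := rot_injective R hxy
  exact h2 ▸ hy

namespace Crystal

variable {d : ℕ}

/-- The infinite crystal structure: all atoms and their lattice repeats, with their features. -/
def infinite (M : Crystal d) : Set (E3 × Feature d) :=
  {s | ∃ (i : Fin M.n) (k : Fin 3 → ℤ),
    s.1 = M.P i + ∑ m, (k m : ℝ) • M.L m ∧ s.2 = M.A i}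

/-- The volume of the unit cell. -/
def cellVolume (M : Crystal d) : ℝ := |(cellMatrix M.L).det|

/-- `M` is a minimum unit cell representation: no representation of the same infinite structure
has a cell of smaller volume. -/
def IsMinimal (M : Crystal d) : Prop :=
  ∀ M' : Crystal d, M'.infinite = M.infinite → M.cellVolume ≤ M'.cellVolume

/-- The description `(A, R P + b, R L)`. -/
def rigid (M : Crystal d) (R : Matrix.specialOrthogonalGroup (Fin 3) ℝ) (b : E3) : Crystal d where
  n := M.n
  A := M.A
  P := fun i => rot R (M.P i) + b
  L := fun k => rot R (M.L k)
  n_pos := M.n_pos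
  linInd := M.linInd.map' (rot R) (LinearMap.ker_eq_bot.2 (rot_injective R))
  distinct := by
    intro i j h
    apply M.distinct
    apply mem_lattice_rot R
    rw [map_sub]
    simpa using h

end Crystal

/-- Periodic invariance: equal values on all minimum unit cell representations of the same
infinite crystal structure. -/
def PeriodicInvariant {d : ℕ} {X : Type*} (f : Crystal d → X) : Prop :=
  ∀ M M' : Crystal d, M.IsMinimal → M'.IsMinimal → M.infinite = M'.infinite → f M = f M'

/-- Unit cell `SE(3)` invariance. -/
def UnitCellSE3Invariant {d : ℕ} {X : Type*} (f : Crystal d → X) : Prop :=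
  ∀ (M : Crystal d) (R : Matrix.specialOrthogonalGroup (Fin 3) ℝ) (b : E3),
    f M = f (M.rigid R b)

/-! ### Lattice vectors -/

/-- The inner product of two vectors of a frame. -/
def dot (B : Fin 3 → E3) (i j : Fin 3) : ℝ := inner ℝ (B i) (B j)

/-- Niggli's conditions common to the two types of reduced cells. -/
def NiggliCommon (B : Fin 3 → E3) : Prop :=
  dot B 0 0 ≤ dot B 1 1 ∧ dot B 1 1 ≤ dot B 2 2 ∧
  2 * |dot B 1 2| ≤ dot B 1 1 ∧ 2 * |dot B 0 2| ≤ dot B 0 0 ∧ 2 * |dot B 0 1| ≤ dot B 0 0 ∧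
  (dot B 0 0 = dot B 1 1 → |dot B 1 2| ≤ |dot B 0 2|) ∧
  (dot B 1 1 = dot B 2 2 → |dot B 0 2| ≤ |dot B 0 1|)

/-- Niggli's conditions for type I (all three angles acute). -/
def NiggliTypeI (B : Fin 3 → E3) : Prop :=
  0 < dot B 1 2 ∧ 0 < dot B 0 2 ∧ 0 < dot B 0 1 ∧
  (2 * dot B 1 2 = dot B 1 1 → dot B 0 1 ≤ 2 * dot B 0 2) ∧
  (2 * dot B 0 2 = dot B 0 0 → dot B 0 1 ≤ 2 * dot B 1 2) ∧
  (2 * dot B 0 1 = dot B 0 0 → dot B 0 2 ≤ 2 * dot B 1 2)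

/-- Niggli's conditions for type II (no angle acute). -/
def NiggliTypeII (B : Fin 3 → E3) : Prop :=
  dot B 1 2 ≤ 0 ∧ dot B 0 2 ≤ 0 ∧ dot B 0 1 ≤ 0 ∧
  2 * (|dot B 1 2| + |dot B 0 2| + |dot B 0 1|) ≤ dot B 0 0 + dot B 1 1 ∧
  (2 * |dot B 1 2| = dot B 1 1 → dot B 0 1 = 0) ∧
  (2 * |dot B 0 2| = dot B 0 0 → dot B 0 1 = 0) ∧
  (2 * |dot B 0 1| = dot B 0 0 → dot B 0 2 = 0) ∧
  (2 * (|dot B 1 2| + |dot B 0 2| + |dot B 0 1|) = dot B 0 0 + dot B 1 1 →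
    dot B 0 0 ≤ 2 * |dot B 0 2| + |dot B 0 1|)

/-- `B` is a right-handed Niggli-reduced basis of the lattice of the vectors `L`. -/
def IsNiggliBasis (L B : Fin 3 → E3) : Prop :=
  lattice B = lattice L ∧ 0 < (cellMatrix B).det ∧
  NiggliCommon B ∧ (NiggliTypeI B ∨ NiggliTypeII B)

/-! ### Origin of the cell -/

/-- Fractional coordinates `x` of `p`, so that `p = x₀ B₀ + x₁ B₁ + x₂ B₂`. -/
def frac (B : Fin 3 → E3) (p : E3) : Fin 3 → ℝ := (cellMatrix B)⁻¹.mulVec p.ofLp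

variable {d : ℕ}

/-- The atoms of the infinite structure within distance `r` of atom `i`, other than the atom
itself (its periodic repeats are included). -/
def neighbors (M : Crystal d) (r : ℝ) (i : Fin M.n) : Set (E3 × Feature d) :=
  {s | s ∈ M.infinite ∧ s.1 ≠ M.P i ∧ dist s.1 (M.P i) ≤ r}

/-- The local density of atom `i`. -/
def localDensity (Z : Feature d → ℕ) (r : ℝ) (M : Crystal d) (i : Fin M.n) : ℕ :=
  ∑ᶠ s ∈ neighbors M r i, Z s.2

/-- The density of atom `i` along the lattice vector `B k`: only neighbors with larger `k`-th
fractional coordinate count. -/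
def directionalDensity (Z : Feature d → ℕ) (r : ℝ) (M : Crystal d) (B : Fin 3 → E3) (k : Fin 3)
    (i : Fin M.n) : ℕ :=
  ∑ᶠ s ∈ {s | s ∈ neighbors M r i ∧ frac B (M.P i) k < frac B s.1 k}, Z s.2

/-- The criteria for the origin, in order of priority. -/
def originKey (Z : Feature d → ℕ) (r : ℝ) (M : Crystal d) (B : Fin 3 → E3) (i : Fin M.n) :
    Lex (Fin 5 → ℕ) :=
  toLex ![Z (M.A i), localDensity Z r M i, directionalDensity Z r M B 0 i,
    directionalDensity Z r M B 1 i, directionalDensity Z r M B 2 i]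

/-- The lattice frame `B` and the origin atom `o` comply with the selection rules: `B` is a
right-handed Niggli basis, and no atom of the cell precedes `o` in the lexicographic order of atomic
number, local density and the three directional densities. -/
def IsChoice (Z : Feature d → ℕ) (r : ℝ) (M : Crystal d) (B : Fin 3 → E3) (o : Fin M.n) : Prop :=
  IsNiggliBasis M.L B ∧ ∀ j, originKey Z r M B o ≤ originKey Z r M B j

/-- Fractional coordinates of atom `j` in the cell with frame `B` and atom `o` at the origin. -/
def cellFrac (M : Crystal d) (B : Fin 3 → E3) (o j : Fin M.n) : Fin 3 → ℝ :=
  fun k => Int.fract (frac B (M.P j) k - frac B (M.P o) k)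

/-- A unit cell `(A, P, L)` up to the numbering of its atoms: lattice vectors, and the set of
positions with features. -/
structure UnitCell (d : ℕ) where
  L : Fin 3 → E3
  atoms : Set (E3 × Feature d)

/-- The unit cell `(A, R P, R L)`. -/
def UnitCell.rotate (R : Matrix.specialOrthogonalGroup (Fin 3) ℝ) (U : UnitCell d) :
    UnitCell d where
  L := fun k => rot R (U.L k)
  atoms := (fun s => (rot R s.1, s.2)) '' U.atoms

/-- The unit cell for the frame `B` and the origin atom `o`. -/
def unitCellOf (M : Crystal d) (B : Fin 3 → E3) (o : Fin M.n) : UnitCell d where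
  L := B
  atoms := Set.range fun j => (∑ k, cellFrac M B o j k • B k, M.A j)

/-- The unit cells that the selection rules admit (one, if the rules leave no tie). -/
def unitCells (Z : Feature d → ℕ) (r : ℝ) (M : Crystal d) : Set (UnitCell d) :=
  {U | ∃ B o, IsChoice Z r M B o ∧ U = unitCellOf M B o}

/-! ### Space group -/

/-- The space group: the isometries of space that preserve the infinite structure. -/
def spaceGroup (M : Crystal d) : Subgroup (E3 ≃ᵃ[ℝ] E3) where
  carrier := {g | Isometry g ∧ ∀ p a, (g p, a) ∈ M.infinite ↔ (p, a) ∈ M.infinite}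
  one_mem' := ⟨isometry_id, fun _ _ => Iff.rfl⟩
  mul_mem' := by
    rintro g h ⟨hg, hg'⟩ ⟨hh, hh'⟩
    exact ⟨hg.comp hh, fun p a => (hg' (h p) a).trans (hh' p a)⟩
  inv_mem' := by
    rintro g ⟨hg, hg'⟩
    refine ⟨hg.right_inv fun x => g.apply_symm_apply x, fun p a => ?_⟩
    have := hg' (g.symm p) a
    rw [g.apply_symm_apply] at this
    exact this.symm

/-- The space group type, which the space group symbol names: the class of the space group under
conjugation by orientation-preserving affine maps. -/
def spaceGroupType (M : Crystal d) : Set (Subgroup (E3 ≃ᵃ[ℝ] E3)) :=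
  {H | ∃ φ : E3 ≃ᵃ[ℝ] E3, 0 < LinearMap.det (φ.linear : E3 →ₗ[ℝ] E3) ∧
    H = (spaceGroup M).map (MulAut.conj φ).toMonoidHom}

/-- A symmetry transformation `x ↦ W x + w` in fractional coordinates. -/
abbrev FracOp := Matrix (Fin 3) (Fin 3) ℝ × (Fin 3 → ℝ)

/-- The space group transformations in fractional coordinates of the cell with frame `B` and
origin atom `o`, with translation parts reduced modulo one. -/
def fracSymmetries (M : Crystal d) (B : Fin 3 → E3) (o : Fin M.n) : Set FracOp :=
  {T | ∃ g ∈ spaceGroup M,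
    T.1 = Matrix.of (fun k l => frac B (g.linear (B l)) k) ∧
    T.2 = fun k => Int.fract (frac B (g (M.P o) - M.P o) k)}

/-- Atoms `i` and `j` of the cell are equivalent if some symmetry maps `i` to `j`. Lattice
translations are symmetries, so repeats of `j` need not be mentioned. -/
def AtomEquiv (M : Crystal d) (i j : Fin M.n) : Prop :=
  ∃ g ∈ spaceGroup M, g (M.P i) = M.P j

open Classical in
/-- The number of atoms of the cell that are recovered from atom `i` by symmetry. -/
def multiplicity (M : Crystal d) (i : Fin M.n) : ℕ :=
  (Finset.univ.filter fun j => AtomEquiv M i j).card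

open Classical in
/-- The irreducible atom set: from each class of equivalent atoms the one whose fractional
coordinates come first in the lexicographic order. -/
def irreducibleAtoms (M : Crystal d) (B : Fin 3 → E3) (o : Fin M.n) : Finset (Fin M.n) :=
  Finset.univ.filter fun i => ∀ j, AtomEquiv M i j →
    toLex (cellFrac M B o i) ≤ toLex (cellFrac M B o j)

/-! ### The sequence -/

/-- The entries of sequences. -/
inductive Token where
  | atomType (z : ℕ)
  | count (m : ℕ)
  | spaceGroupSymbol (t : Set (Subgroup (E3 ≃ᵃ[ℝ] E3)))
  | symmetries (S : Set FracOp)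
  | real (x : ℝ)

/-- Compositional information: number of atoms in the cell, then the atom types with their numbers
of atoms, by increasing atomic number. -/
def compositionTokens (Z : Feature d → ℕ) (M : Crystal d) : List Token :=
  Token.count M.n ::
    ((Finset.univ.image fun i => Z (M.A i)).sort (· ≤ ·)).flatMap fun z =>
      [Token.atomType z, Token.count (Finset.univ.filter fun i => Z (M.A i) = z).card]

/-- The lattice parameters `a, b, c, α, β, γ`. -/
def latticeTokens (B : Fin 3 → E3) : List Token :=
  [Token.real ‖B 0‖, Token.real ‖B 1‖, Token.real ‖B 2‖,
    Token.real (InnerProductGeometry.angle (B 1) (B 2)),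
    Token.real (InnerProductGeometry.angle (B 0) (B 2)),
    Token.real (InnerProductGeometry.angle (B 0) (B 1))]

/-- The atom key by which the irreducible atoms are ordered: atomic number, multiplicity, fractional
coordinates. -/
abbrev AtomKey := ℕ ×ₗ ℕ ×ₗ Lex (Fin 3 → ℝ)

def atomKey (Z : Feature d → ℕ) (M : Crystal d) (B : Fin 3 → E3) (o i : Fin M.n) : AtomKey :=
  toLex (Z (M.A i), toLex (multiplicity M i, toLex (cellFrac M B o i)))

/-- The entries `[Z, x, y, z]` of the atom with the given key. -/
def keyTokens (t : AtomKey) : List Token :=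
  let x : Fin 3 → ℝ := ofLex (ofLex (ofLex t).2).2
  [Token.atomType (ofLex t).1, Token.real (x 0), Token.real (x 1), Token.real (x 2)]

/-- The irreducible atoms in order. -/
def atomTokens (Z : Feature d → ℕ) (M : Crystal d) (B : Fin 3 → E3) (o : Fin M.n) : List Token :=
  (((irreducibleAtoms M B o).image (atomKey Z M B o)).sort (· ≤ ·)).flatMap keyTokens

/-- The sequence written for the frame `B` and the origin atom `o`. -/
def sequenceOf (Z : Feature d → ℕ) (M : Crystal d) (B : Fin 3 → E3) (o : Fin M.n) : List Token :=
  compositionTokens Z M ++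
    [Token.spaceGroupSymbol (spaceGroupType M), Token.symmetries (fracSymmetries M B o)] ++
    latticeTokens B ++ atomTokens Z M B o

/-- The sequences that comply with the rules (one, if the rules leave no effective tie). -/
def admissibleSequences (Z : Feature d → ℕ) (r : ℝ) (M : Crystal d) : Set (List Token) :=
  {s | ∃ B o, IsChoice Z r M B o ∧ s = sequenceOf Z M B o}

/-- A rule that selects one element from each nonempty set of sequences. -/
def IsTieBreak (τ : Set (List Token) → List Token) : Prop :=
  ∀ S : Set (List Token), S.Nonempty → τ S ∈ S

/-- The map Mat2Seq, where remaining ties are broken by `τ`. -/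
def mat2Seq (Z : Feature d → ℕ) (r : ℝ) (τ : Set (List Token) → List Token) (M : Crystal d) :
    List Token :=
  τ (admissibleSequences Z r M)

end Mat2Seq

end

noncomputable section

namespace Mat2Seq

/-! ### Frames and their lattices -/

/-! Everything a choice refers to (inner products of the frame, fractional coordinates modulo one,
distances, symmetries) is geometric. It is therefore unchanged when a description is rotated,
translated, renumbered, or has single atoms shifted by lattice vectors. `IsCongruence` collects
these changes. Under a congruence the choices correspond bijectively, unit cells are rotated, and
the set of admissible sequences stays the same. All statements concern sets of choices, so no
uniqueness of the reduced basis or of the origin is needed.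

Rigid motions are congruences by construction. Two minimum representations of one structure are
congruent with trivial rotation (`exists_isCongruence_one`). The translations of the structure form
a lattice containing the cell lattice, and some description has exactly this lattice, so minimal
volume forces equality (`IsMinimal.lattice_eq_translations`). Equal lattices then match the atoms
class by class.

Existence of a choice rests on `exists_isNiggliBasis`. Among the bases of least total squared
length, sorted by length, one maximizes a weighted sum of the absolute off-diagonal Gram entries.
Comparing it with a few elementary changes of basis gives all Niggli conditions, once signs and
orientation are adjusted. -/

theorem mem_lattice_self (B : Fin 3 → E3) (k : Fin 3) : B k ∈ lattice B :=
  Submodule.subset_span ⟨k, rfl⟩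

theorem lattice_le {B : Fin 3 → E3} {Λ : Submodule ℤ E3} (h : ∀ k, B k ∈ Λ) : lattice B ≤ Λ :=
  Submodule.span_le.2 (by rintro _ ⟨k, rfl⟩; exact h k)

theorem lattice_eq_of_mem {B B' : Fin 3 → E3} (h : ∀ k, B k ∈ lattice B')
    (h' : ∀ k, B' k ∈ lattice B) : lattice B = lattice B' :=
  le_antisymm (lattice_le h) (lattice_le h')

theorem mem_lattice_iff {B : Fin 3 → E3} {x : E3} :
    x ∈ lattice B ↔ ∃ k : Fin 3 → ℤ, ∑ m, (k m : ℝ) • B m = x := by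
  unfold lattice
  rw [Submodule.mem_span_range_iff_exists_fun]
  simp only [Int.cast_smul_eq_zsmul]

theorem cellMatrix_mulVec (B : Fin 3 → E3) (x : Fin 3 → ℝ) :
    (cellMatrix B).mulVec x = (∑ k, x k • B k).ofLp := by
  ext i
  simp [cellMatrix, Matrix.mulVec, dotProduct, mul_comm]

theorem det_cellMatrix_ne_zero_iff {B : Fin 3 → E3} :
    (cellMatrix B).det ≠ 0 ↔ LinearIndependent ℝ B := by
  rw [← isUnit_iff_ne_zero, ← Matrix.isUnit_iff_isUnit_det,
    ← Matrix.linearIndependent_cols_iff_isUnit]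
  have : (cellMatrix B).col = (WithLp.linearEquiv 2 ℝ (Fin 3 → ℝ)) ∘ B := by
    ext k i; simp [cellMatrix]
  rw [this]
  exact LinearMap.linearIndependent_iff (WithLp.linearEquiv 2 ℝ (Fin 3 → ℝ)).toLinearMap
    (LinearMap.ker_eq_bot.2 (WithLp.linearEquiv 2 ℝ (Fin 3 → ℝ)).injective)

/-- Three linearly independent vectors form a basis of space. -/
def frameBasis (B : Fin 3 → E3) (h : LinearIndependent ℝ B) : Module.Basis (Fin 3) ℝ E3 :=
  basisOfLinearIndependentOfCardEqFinrank h (by simp)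

@[simp] theorem coe_frameBasis (B : Fin 3 → E3) (h : LinearIndependent ℝ B) :
    ⇑(frameBasis B h) = B := by simp [frameBasis]

theorem finite_lattice_inter {B : Fin 3 → E3} (h : LinearIndependent ℝ B) {s : Set E3}
    (hs : Bornology.IsBounded s) : (s ∩ (lattice B : Set E3)).Finite := by
  have := ZSpan.setFinite_inter (frameBasis B h) hs
  rwa [coe_frameBasis] at this

theorem linearIndependent_of_lattice_le {L B : Fin 3 → E3} (hL : LinearIndependent ℝ L)
    (h : lattice L ≤ lattice B) : LinearIndependent ℝ B := by
  apply linearIndependent_of_top_le_span_of_card_eq_finrank _ (by simp)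
  rw [← (frameBasis L hL).span_eq, coe_frameBasis, Submodule.span_le]
  rintro _ ⟨k, rfl⟩
  exact Submodule.span_le_restrictScalars ℤ ℝ _ (h (mem_lattice_self L k))

/-! ### Existence of Niggli-reduced bases -/

theorem lattice_replace_two (B : Fin 3 → E3) {s : ℤ} (m n : ℤ) (hs : s * s = 1) :
    lattice ![B 0, B 1, s • B 2 + m • B 0 + n • B 1] = lattice B := by
  apply lattice_eq_of_mem
  · have h0 := mem_lattice_self B 0
    have h1 := mem_lattice_self B 1
    have h2 := mem_lattice_self B 2
    intro k
    fin_cases k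
    · exact h0
    · exact h1
    · exact add_mem (add_mem (Submodule.smul_mem _ _ h2) (Submodule.smul_mem _ _ h0))
        (Submodule.smul_mem _ _ h1)
  · set B' := ![B 0, B 1, s • B 2 + m • B 0 + n • B 1] with hB'
    have h0 : B 0 ∈ lattice B' := mem_lattice_self B' 0
    have h1 : B 1 ∈ lattice B' := mem_lattice_self B' 1
    have h2 : s • B 2 + m • B 0 + n • B 1 ∈ lattice B' := mem_lattice_self B' 2
    intro k
    fin_cases k
    · exact h0
    · exact h1
    · have h3 : B 2 = s • ((s • B 2 + m • B 0 + n • B 1) - m • B 0 - n • B 1) := by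
        rw [add_sub_right_comm, add_sub_cancel_right, add_sub_cancel_right, smul_smul, hs,
          one_smul]
      change B 2 ∈ _
      rw [h3]
      exact Submodule.smul_mem _ _ (sub_mem (sub_mem h2 (Submodule.smul_mem _ _ h0))
        (Submodule.smul_mem _ _ h1))

theorem lattice_comp_perm (B : Fin 3 → E3) (σ : Equiv.Perm (Fin 3)) :
    lattice (B ∘ σ) = lattice B := by
  unfold lattice
  rw [σ.surjective.range_comp]

theorem lattice_replace_one (B : Fin 3 → E3) {s : ℤ} (m : ℤ) (hs : s * s = 1) :
    lattice ![B 0, s • B 1 + m • B 0, B 2] = lattice B := by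
  have h := lattice_replace_two (B ∘ Equiv.swap 1 2) m 0 hs
  rw [lattice_comp_perm, ← lattice_comp_perm _ (Equiv.swap 1 2)] at h
  rw [← h]
  congr 1
  ext k : 1
  fin_cases k <;> simp [Equiv.swap_apply_def]

/-- The trace of the Gram matrix. -/
def gramTrace (B : Fin 3 → E3) : ℝ := dot B 0 0 + dot B 1 1 + dot B 2 2

/-- A weighted sum of the off-diagonal entries of the Gram matrix. Among the shortest bases of a
lattice, Niggli's tie-breaking conditions hold where it is largest. -/
def gramWeight (B : Fin 3 → E3) : ℝ := |dot B 1 2| + 2 * |dot B 0 2| + 3 * |dot B 0 1|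

def SortedByLength (B : Fin 3 → E3) : Prop := dot B 0 0 ≤ dot B 1 1 ∧ dot B 1 1 ≤ dot B 2 2

/-- The trace is minimized over all bases, but the weight is maximized only over sorted bases of the
same trace. A competitor for the weight must therefore be shown to be sorted as well. -/
structure IsOptimalBasis (Λ : Submodule ℤ E3) (B : Fin 3 → E3) : Prop where
  lattice_eq : lattice B = Λ
  sorted : SortedByLength B
  gramTrace_le : ∀ B', lattice B' = Λ → gramTrace B ≤ gramTrace B'
  gramWeight_le : ∀ B', lattice B' = Λ → SortedByLength B' → gramTrace B' = gramTrace B →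
    gramWeight B' ≤ gramWeight B

theorem dot_self_nonneg (B : Fin 3 → E3) (i : Fin 3) : 0 ≤ dot B i i := real_inner_self_nonneg

theorem dot_comm (B : Fin 3 → E3) (i j : Fin 3) : dot B i j = dot B j i := real_inner_comm _ _

theorem finite_bases_gramTrace_le {L : Fin 3 → E3} (hL : LinearIndependent ℝ L) (K : ℝ) :
    {B : Fin 3 → E3 | lattice B = lattice L ∧ gramTrace B ≤ K}.Finite := by
  have h1 := finite_lattice_inter hL (Metric.isBounded_closedBall (x := (0 : E3)) (r := √K))
  refine (Set.Finite.pi' fun _ : Fin 3 => h1).subset ?_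
  rintro B ⟨hB, hK⟩ i
  refine ⟨?_, hB ▸ mem_lattice_self B i⟩
  rw [mem_closedBall_zero_iff]
  apply Real.le_sqrt_of_sq_le
  have h2 : dot B i i = ‖B i‖ ^ 2 := real_inner_self_eq_norm_sq _
  rw [← h2]
  have := dot_self_nonneg B 0
  have := dot_self_nonneg B 1
  have := dot_self_nonneg B 2
  unfold gramTrace at hK
  fin_cases i <;> simp <;> linarith

theorem gramTrace_comp_perm (B : Fin 3 → E3) (σ : Equiv.Perm (Fin 3)) :
    gramTrace (B ∘ σ) = gramTrace B := by
  have h : ∀ B, gramTrace B = ∑ i, dot B i i := fun B => by rw [Fin.sum_univ_three]; rfl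
  rw [h, h]
  exact Equiv.sum_comp σ fun i => dot B i i

theorem exists_isOptimalBasis {L : Fin 3 → E3} (hL : LinearIndependent ℝ L) :
    ∃ B, IsOptimalBasis (lattice L) B := by
  obtain ⟨B₀, ⟨hB₀, hB₀'⟩, hmin⟩ := Set.exists_min_image _ gramTrace
    (finite_bases_gramTrace_le hL (gramTrace L)) ⟨L, rfl, le_rfl⟩
  have hmin' : ∀ B', lattice B' = lattice L → gramTrace B₀ ≤ gramTrace B' := by
    intro B' hB'
    rcases le_total (gramTrace B') (gramTrace L) with h | h
    · exact hmin B' ⟨hB', h⟩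
    · exact hB₀'.trans h
  -- Sorting by length keeps the lattice and the trace, so the set over which the weight is
  -- maximized is nonempty.
  let σ := Tuple.sort fun i => dot B₀ i i
  have hσ : Monotone ((fun i => dot B₀ i i) ∘ σ) := Tuple.monotone_sort _
  obtain ⟨B, ⟨hB, hBs, hBt⟩, hmax⟩ := Set.exists_max_image
    {B | lattice B = lattice L ∧ SortedByLength B ∧ gramTrace B = gramTrace B₀} gramWeight
    ((finite_bases_gramTrace_le hL (gramTrace L)).subset fun B h => ⟨h.1, h.2.2 ▸ hB₀'⟩)
    ⟨B₀ ∘ σ, (lattice_comp_perm _ _).trans hB₀,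
      ⟨hσ (by decide : (0 : Fin 3) ≤ 1), hσ (by decide : (1 : Fin 3) ≤ 2)⟩,
      gramTrace_comp_perm _ _⟩
  exact ⟨B, hB, hBs, fun B' h => hBt ▸ hmin' B' h,
    fun B' h1 h2 h3 => hmax B' ⟨h1, h2, h3.trans hBt⟩⟩

/-- Flip the directions of some of the vectors of a frame. -/
def flipSigns (s : Fin 3 → ℤˣ) (B : Fin 3 → E3) : Fin 3 → E3 := fun k => s k • B k

theorem dot_flipSigns (s : Fin 3 → ℤˣ) (B : Fin 3 → E3) (i j : Fin 3) :
    dot (flipSigns s B) i j = (s i : ℤ) * (s j : ℤ) * dot B i j := by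
  simp only [dot, flipSigns, Units.smul_def, ← Int.cast_smul_eq_zsmul ℝ, inner_smul_left,
    inner_smul_right]
  simp
  ring

theorem lattice_flipSigns (s : Fin 3 → ℤˣ) (B : Fin 3 → E3) :
    lattice (flipSigns s B) = lattice B := by
  have h : ∀ s B, ∀ k, flipSigns s B k ∈ lattice B := fun s B k =>
    Submodule.smul_mem _ _ (mem_lattice_self B k)
  refine lattice_eq_of_mem (h s B) fun k => ?_
  have h2 := h s (flipSigns s B) k
  simpa [flipSigns, smul_smul] using h2

theorem IsOptimalBasis.flipSigns {Λ : Submodule ℤ E3} {B : Fin 3 → E3} (h : IsOptimalBasis Λ B)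
    (s : Fin 3 → ℤˣ) : IsOptimalBasis Λ (flipSigns s B) := by
  have h1 : ∀ i, dot (Mat2Seq.flipSigns s B) i i = dot B i i := fun i => by
    rw [dot_flipSigns]; rcases Int.units_eq_one_or (s i) with h | h <;> simp [h]
  have h2 : ∀ i j, |dot (Mat2Seq.flipSigns s B) i j| = |dot B i j| := fun i j => by
    rw [dot_flipSigns]
    rcases Int.units_eq_one_or (s i) with h | h <;> rcases Int.units_eq_one_or (s j) with h' | h' <;>
      simp [h, h']
  have h3 : gramTrace (Mat2Seq.flipSigns s B) = gramTrace B := by simp [gramTrace, h1]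
  have h4 : gramWeight (Mat2Seq.flipSigns s B) = gramWeight B := by simp [gramWeight, h2]
  refine ⟨(lattice_flipSigns s B).trans h.lattice_eq, by simpa [SortedByLength, h1] using h.sorted,
    ?_, ?_⟩
  · rw [h3]; exact h.gramTrace_le
  · rw [h3, h4]; exact h.gramWeight_le

/-- Here `q` is the change in squared length when `B 2` is replaced by `s • B 2 + m • B 0 + n • B
1`, which is again a basis as `s` is a sign. Minimal trace gives `0 ≤ q`. If `q = 0`, the new basis
is still sorted and equally short, so its weight cannot be larger; the term of `dot B 0 1` is common
to both weights and cancels. -/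
theorem IsOptimalBasis.replace_two {Λ : Submodule ℤ E3} {B : Fin 3 → E3} (h : IsOptimalBasis Λ B)
    {s : ℤ} (m n : ℤ) (hs : s * s = 1) {q : ℝ}
    (hq : q = m ^ 2 * dot B 0 0 + n ^ 2 * dot B 1 1 + 2 * s * m * dot B 0 2 + 2 * s * n * dot B 1 2
      + 2 * m * n * dot B 0 1) :
    0 ≤ q ∧ (q = 0 → |s * dot B 1 2 + m * dot B 0 1 + n * dot B 1 1| +
      2 * |s * dot B 0 2 + m * dot B 0 0 + n * dot B 0 1| ≤ |dot B 1 2| + 2 * |dot B 0 2|) := by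
  set B' : Fin 3 → E3 := ![B 0, B 1, s • B 2 + m • B 0 + n • B 1] with hB'
  have hL : lattice B' = Λ := (lattice_replace_two B m n hs).trans h.lattice_eq
  have hs' : (s : ℝ) * s = 1 := by exact_mod_cast hs
  have e2 : B' 2 = (s : ℝ) • B 2 + (m : ℝ) • B 0 + (n : ℝ) • B 1 := by
    simp [hB', Int.cast_smul_eq_zsmul]
  have d00 : dot B' 0 0 = dot B 0 0 := rfl
  have d11 : dot B' 1 1 = dot B 1 1 := rfl
  have d01 : dot B' 0 1 = dot B 0 1 := rfl
  have d02 : dot B' 0 2 = s * dot B 0 2 + m * dot B 0 0 + n * dot B 0 1 := by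
    simp only [dot, e2, inner_add_right, inner_smul_right]
    rfl
  have d12 : dot B' 1 2 = s * dot B 1 2 + m * dot B 0 1 + n * dot B 1 1 := by
    rw [dot_comm B 0 1]
    simp only [dot, e2, inner_add_right, inner_smul_right]
    rfl
  have d22 : dot B' 2 2 = dot B 2 2 + q := by
    have : dot B' 2 2 = s * s * dot B 2 2 + m ^ 2 * dot B 0 0 + n ^ 2 * dot B 1 1 +
        2 * s * m * dot B 0 2 + 2 * s * n * dot B 1 2 + 2 * m * n * dot B 0 1 := by
      simp only [dot, e2, inner_add_right, inner_smul_right, inner_add_left, real_inner_smul_left]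
      rw [real_inner_comm (B 0) (B 2), real_inner_comm (B 1) (B 2), real_inner_comm (B 0) (B 1)]
      ring
    rw [this, hs', hq]; ring
  have ht := h.gramTrace_le B' hL
  have hw := h.gramWeight_le B' hL
  have hso := h.sorted
  simp only [gramTrace, gramWeight, SortedByLength, d00, d11, d01, d02, d12, d22] at ht hw hso
  refine ⟨by linarith, fun hq0 => ?_⟩
  have := hw ⟨hso.1, by linarith⟩ (by linarith)
  linarith

theorem IsOptimalBasis.replace_one {Λ : Submodule ℤ E3} {B : Fin 3 → E3} (h : IsOptimalBasis Λ B)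
    {s : ℤ} (m : ℤ) (hs : s * s = 1) {q : ℝ}
    (hq : q = m ^ 2 * dot B 0 0 + 2 * s * m * dot B 0 1) :
    0 ≤ q ∧ (q = 0 → |s * dot B 1 2 + m * dot B 0 2| +
      3 * |s * dot B 0 1 + m * dot B 0 0| ≤ |dot B 1 2| + 3 * |dot B 0 1|) := by
  set B' : Fin 3 → E3 := ![B 0, s • B 1 + m • B 0, B 2] with hB'
  have hL : lattice B' = Λ := (lattice_replace_one B m hs).trans h.lattice_eq
  have hs' : (s : ℝ) * s = 1 := by exact_mod_cast hs
  have e1 : B' 1 = (s : ℝ) • B 1 + (m : ℝ) • B 0 := by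
    simp [hB', Int.cast_smul_eq_zsmul]
  have d00 : dot B' 0 0 = dot B 0 0 := rfl
  have d22 : dot B' 2 2 = dot B 2 2 := rfl
  have d02 : dot B' 0 2 = dot B 0 2 := rfl
  have d01 : dot B' 0 1 = s * dot B 0 1 + m * dot B 0 0 := by
    simp only [dot, e1, inner_add_right, inner_smul_right]
    rfl
  have d12 : dot B' 1 2 = s * dot B 1 2 + m * dot B 0 2 := by
    simp only [dot, e1, inner_add_left, real_inner_smul_left]
    rfl
  have d11 : dot B' 1 1 = dot B 1 1 + q := by
    have : dot B' 1 1 = s * s * dot B 1 1 + m ^ 2 * dot B 0 0 + 2 * s * m * dot B 0 1 := by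
      simp only [dot, e1, inner_add_right, inner_smul_right, inner_add_left, real_inner_smul_left]
      rw [real_inner_comm (B 0) (B 1)]
      ring
    rw [this, hs', hq]; ring
  have ht := h.gramTrace_le B' hL
  have hw := h.gramWeight_le B' hL
  have hso := h.sorted
  simp only [gramTrace, gramWeight, SortedByLength, d00, d11, d01, d02, d12, d22] at ht hw hso
  refine ⟨by linarith, fun hq0 => ?_⟩
  have := hw ⟨by linarith, by linarith⟩ (by linarith)
  linarith

/-- Exchanging two vectors of equal length keeps the basis sorted and exchanges two terms of the
weight. The larger coefficient must therefore sit at the larger entry; this is what the increasing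
coefficients 1, 2, 3 are for. -/
theorem IsOptimalBasis.swap_zero_one {Λ : Submodule ℤ E3} {B : Fin 3 → E3}
    (h : IsOptimalBasis Λ B) (hd : dot B 0 0 = dot B 1 1) : |dot B 1 2| ≤ |dot B 0 2| := by
  have h1 := h.gramWeight_le (B ∘ Equiv.swap 0 1) ((lattice_comp_perm _ _).trans h.lattice_eq)
    ⟨hd.ge, hd ▸ h.sorted.2⟩ (gramTrace_comp_perm _ _)
  have h2 : gramWeight (B ∘ Equiv.swap 0 1) = |dot B 0 2| + 2 * |dot B 1 2| + 3 * |dot B 1 0| := rfl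
  rw [h2, dot_comm B 1 0, gramWeight] at h1
  linarith

theorem IsOptimalBasis.swap_one_two {Λ : Submodule ℤ E3} {B : Fin 3 → E3}
    (h : IsOptimalBasis Λ B) (hd : dot B 1 1 = dot B 2 2) : |dot B 0 2| ≤ |dot B 0 1| := by
  have h1 := h.gramWeight_le (B ∘ Equiv.swap 1 2) ((lattice_comp_perm _ _).trans h.lattice_eq)
    ⟨h.sorted.1.trans hd.le, hd.ge⟩ (gramTrace_comp_perm _ _)
  have h2 : gramWeight (B ∘ Equiv.swap 1 2) = |dot B 2 1| + 2 * |dot B 0 1| + 3 * |dot B 0 2| := rfl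
  rw [h2, dot_comm B 2 1, gramWeight] at h1
  linarith

theorem IsOptimalBasis.niggliCommon {Λ : Submodule ℤ E3} {B : Fin 3 → E3}
    (h : IsOptimalBasis Λ B) : NiggliCommon B := by
  have c1 := (h.replace_two (s := 1) 0 1 (by norm_num) rfl).1
  have c2 := (h.replace_two (s := 1) 0 (-1) (by norm_num) rfl).1
  have c3 := (h.replace_two (s := 1) 1 0 (by norm_num) rfl).1
  have c4 := (h.replace_two (s := 1) (-1) 0 (by norm_num) rfl).1
  have c5 := (h.replace_one (s := 1) 1 (by norm_num) rfl).1
  have c6 := (h.replace_one (s := 1) (-1) (by norm_num) rfl).1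
  norm_num at c1 c2 c3 c4 c5 c6
  have aux : ∀ x y : ℝ, 0 ≤ y + 2 * x → 2 * x ≤ y → 2 * |x| ≤ y := fun x y h1 h2 => by
    rcases abs_cases x with h | h <;> linarith
  exact ⟨h.sorted.1, h.sorted.2, aux _ _ c1 c2, aux _ _ c3 c4, aux _ _ c5 c6,
    h.swap_zero_one, h.swap_one_two⟩

/-- Each boundary equality says that reflecting one vector, as in `B 1 - B 2`, preserves its length.
The reflection also preserves the entry occurring in the equality, so maximal weight bounds the
other entry that changes. -/
theorem IsOptimalBasis.niggliTypeI {Λ : Submodule ℤ E3} {B : Fin 3 → E3}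
    (h : IsOptimalBasis Λ B) (hD : 0 < dot B 1 2) (hE : 0 < dot B 0 2) (hF : 0 < dot B 0 1) :
    NiggliTypeI B := by
  have c1 := (h.replace_two (s := -1) 0 1 (by norm_num) rfl).2
  have c2 := (h.replace_two (s := -1) 1 0 (by norm_num) rfl).2
  have c3 := (h.replace_one (s := -1) 1 (by norm_num) rfl).2
  norm_num at c1 c2 c3
  rw [abs_of_pos hD, abs_of_pos hE] at c1 c2
  rw [abs_of_pos hD, abs_of_pos hF] at c3
  refine ⟨hD, hE, hF, fun h1 => ?_, fun h1 => ?_, fun h1 => ?_⟩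
  · have := c1 (by linarith)
    have := le_abs_self (-dot B 1 2 + dot B 1 1)
    have := le_abs_self (-dot B 0 2 + dot B 0 1)
    linarith
  · have := c2 (by linarith)
    have := le_abs_self (-dot B 1 2 + dot B 0 1)
    have := le_abs_self (-dot B 0 2 + dot B 0 0)
    linarith
  · have := c3 (by linarith)
    have := le_abs_self (-dot B 1 2 + dot B 0 2)
    have := le_abs_self (-dot B 0 1 + dot B 0 0)
    linarith

theorem IsOptimalBasis.niggliTypeII {Λ : Submodule ℤ E3} {B : Fin 3 → E3}
    (h : IsOptimalBasis Λ B) (hD : dot B 1 2 ≤ 0) (hE : dot B 0 2 ≤ 0) (hF : dot B 0 1 ≤ 0) :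
    NiggliTypeII B := by
  have c1 := (h.replace_two (s := 1) 0 1 (by norm_num) rfl).2
  have c2 := (h.replace_two (s := 1) 1 0 (by norm_num) rfl).2
  have c3 := (h.replace_one (s := 1) 1 (by norm_num) rfl).2
  -- The sum `B 0 + B 1 + B 2` in place of `B 2` gives the condition on the sum of all three entries
  -- and, in the case of equality, its tie-break.
  have c4 := h.replace_two (s := 1) 1 1 (by norm_num) rfl
  obtain ⟨-, -, hn1, hn2, hn3, -, -⟩ := h.niggliCommon
  norm_num at c1 c2 c3 c4
  rw [abs_of_nonpos hD, abs_of_nonpos hE] at c1 c2 c4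
  rw [abs_of_nonpos hD, abs_of_nonpos hF] at c3
  unfold NiggliTypeII
  rw [abs_of_nonpos hD] at hn1 ⊢
  rw [abs_of_nonpos hE] at hn2 ⊢
  rw [abs_of_nonpos hF] at hn3 ⊢
  refine ⟨hD, hE, hF, by linarith, fun h1 => ?_, fun h1 => ?_, fun h1 => ?_, fun h1 => ?_⟩
  · have := c1 (by linarith)
    have := le_abs_self (dot B 1 2 + dot B 1 1)
    have := neg_le_abs (dot B 0 2 + dot B 0 1)
    linarith
  · have := c2 (by linarith)
    have := neg_le_abs (dot B 1 2 + dot B 0 1)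
    have := le_abs_self (dot B 0 2 + dot B 0 0)
    linarith
  · have := c3 (by linarith)
    have := neg_le_abs (dot B 1 2 + dot B 0 2)
    have := le_abs_self (dot B 0 1 + dot B 0 0)
    linarith
  · have := c4.2 (by linarith)
    have := le_abs_self (dot B 1 2 + dot B 0 1 + dot B 1 1)
    have := le_abs_self (dot B 0 2 + dot B 0 0 + dot B 0 1)
    linarith

theorem exists_units_mul_eq_abs (x : ℝ) : ∃ u : ℤˣ, ((u : ℤ) : ℝ) * x = |x| := by
  rcases abs_choice x with h | h
  · exact ⟨1, by simp [h]⟩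
  · exact ⟨-1, by simp [h]⟩

/-- Sign flips do not change the product of the three off-diagonal entries. If it is positive, all
entries can be made positive; otherwise all can be made nonpositive, a zero entry leaving the other
two signs free. -/
theorem exists_flipSigns_dot (B : Fin 3 → E3) : ∃ s : Fin 3 → ℤˣ,
    (0 < dot (flipSigns s B) 1 2 ∧ 0 < dot (flipSigns s B) 0 2 ∧ 0 < dot (flipSigns s B) 0 1) ∨
    (dot (flipSigns s B) 1 2 ≤ 0 ∧ dot (flipSigns s B) 0 2 ≤ 0 ∧ dot (flipSigns s B) 0 1 ≤ 0) := by
  simp only [dot_flipSigns]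
  generalize dot B 1 2 = D
  generalize dot B 0 2 = E
  generalize dot B 0 1 = F
  obtain ⟨w, hw⟩ := exists_units_mul_eq_abs D
  obtain ⟨v, hv⟩ := exists_units_mul_eq_abs E
  obtain ⟨u, hu⟩ := exists_units_mul_eq_abs F
  have hsq : ∀ u : ℤˣ, ((u : ℤ) : ℝ) * ((u : ℤ) : ℝ) = 1 := fun u => by
    rcases Int.units_eq_one_or u with h | h <;> simp [h]
  have hD := abs_nonneg D
  have hE := abs_nonneg E
  by_cases hF0 : F = 0
  · refine ⟨![1, w * v, -v], Or.inr ⟨?_, ?_, by simp [hF0]⟩⟩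
    · simp; linear_combination hD + (-1 : ℝ) * w * D * hsq v - hw
    · simp; linarith
  by_cases hE0 : E = 0
  · refine ⟨![1, -u, u * w], Or.inr ⟨?_, by simp [hE0], ?_⟩⟩
    · simp; linear_combination hD + (-1 : ℝ) * w * D * hsq u - hw
    · simp; linarith [abs_nonneg F]
  have hE' := abs_pos.2 hE0
  have hF' := abs_pos.2 hF0
  -- With signs `u` and `v` the entries `E` and `F` become positive. Negating both of these signs
  -- makes `E` and `F` negative and leaves the sign of the third entry alone.
  by_cases h : 0 < (u : ℤ) * (v : ℤ) * D
  · refine ⟨![1, u, v], Or.inl ⟨?_, ?_, ?_⟩⟩ <;> simp <;> linarith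
  · refine ⟨![1, -u, -v], Or.inr ⟨?_, ?_, ?_⟩⟩ <;> simp <;> linarith

theorem det_cellMatrix_neg (B : Fin 3 → E3) :
    (cellMatrix (flipSigns (-1) B)).det = -(cellMatrix B).det := by
  have : cellMatrix (flipSigns (-1) B) = -cellMatrix B := by
    ext i k; simp [cellMatrix, flipSigns]
  rw [this, Matrix.det_neg]; norm_num [pow_succ]

theorem exists_isNiggliBasis {L : Fin 3 → E3} (hL : LinearIndependent ℝ L) :
    ∃ B, IsNiggliBasis L B := by
  obtain ⟨B₀, hB₀⟩ := exists_isOptimalBasis hL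
  obtain ⟨s, hs⟩ := exists_flipSigns_dot B₀
  have h : ∃ B, IsOptimalBasis (lattice L) B ∧ 0 < (cellMatrix B).det ∧
      ((0 < dot B 1 2 ∧ 0 < dot B 0 2 ∧ 0 < dot B 0 1) ∨
      (dot B 1 2 ≤ 0 ∧ dot B 0 2 ≤ 0 ∧ dot B 0 1 ≤ 0)) := by
    have h1 := hB₀.flipSigns s
    have h2 := det_cellMatrix_ne_zero_iff.2
      (linearIndependent_of_lattice_le hL h1.lattice_eq.ge)
    rcases h2.lt_or_gt with h3 | h3
    -- In odd dimension, negating all vectors reverses the orientation, while every inner product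
    -- stays the same.
    · refine ⟨_, h1.flipSigns (-1), by rw [det_cellMatrix_neg]; linarith, ?_⟩
      have : ∀ i j, dot (flipSigns (-1) (flipSigns s B₀)) i j = dot (flipSigns s B₀) i j :=
        fun i j => by rw [dot_flipSigns]; simp
      simpa only [this] using hs
    · exact ⟨_, h1, h3, hs⟩
  obtain ⟨B, hB, hdet, hs⟩ := h
  refine ⟨B, hB.lattice_eq, hdet, hB.niggliCommon, ?_⟩
  rcases hs with ⟨h1, h2, h3⟩ | ⟨h1, h2, h3⟩
  · exact Or.inl (hB.niggliTypeI h1 h2 h3)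
  · exact Or.inr (hB.niggliTypeII h1 h2 h3)

/-! ### Translations of the infinite structure -/

/-- Contained in a lattice, `Λ` is discrete; containing a frame, it spans space. Hence it is free of
rank three. -/
theorem exists_lattice_eq {L L' : Fin 3 → E3} {Λ : Submodule ℤ E3} (hL : LinearIndependent ℝ L)
    (hL' : LinearIndependent ℝ L') (h : lattice L ≤ Λ) (h' : Λ ≤ lattice L') :
    ∃ B, lattice B = Λ := by
  have hd : DiscreteTopology (lattice L') := by
    have : DiscreteTopology (Submodule.span ℤ (Set.range (frameBasis L' hL'))) := inferInstance
    rwa [coe_frameBasis] at this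
  have : DiscreteTopology Λ := DiscreteTopology.of_subset (t := (Λ : Set E3)) hd h'
  have hz : IsZLattice ℝ Λ := by
    constructor
    rw [eq_top_iff, ← (frameBasis L hL).span_eq, coe_frameBasis]
    exact Submodule.span_mono (Submodule.subset_span.trans h)
  have : Module.Finite ℤ Λ := ZLattice.module_finite ℝ Λ
  have : Module.Free ℤ Λ := ZLattice.module_free ℝ Λ
  let v : Module.Basis (Fin 3) ℤ Λ := (Module.Free.chooseBasis ℤ Λ).reindex
    (Fintype.equivOfCardEq (by
      rw [← Module.finrank_eq_card_chooseBasisIndex, ZLattice.rank ℝ]; simp))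
  exact ⟨v.ofZLatticeBasis ℝ Λ, v.ofZLatticeBasis_span ℝ⟩

/-- The vectors `L` are integral combinations of `B`. The determinant of the transition matrix is a
nonzero integer of absolute value at most one, so the inverse matrix is integral too. -/
theorem lattice_eq_of_abs_det_le {L B : Fin 3 → E3} (hL : LinearIndependent ℝ L)
    (h : lattice L ≤ lattice B) (hdet : |(cellMatrix L).det| ≤ |(cellMatrix B).det|) :
    lattice L = lattice B := by
  refine le_antisymm h (lattice_le fun k => ?_)
  choose N hN using fun k => mem_lattice_iff.1 (h (mem_lattice_self L k))
  let T : Matrix (Fin 3) (Fin 3) ℤ := Matrix.of fun m k => N k m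
  have h1 : cellMatrix L = cellMatrix B * T.map (Int.castRingHom ℝ) := by
    ext i k
    rw [cellMatrix, Matrix.of_apply, ← hN k, Matrix.mul_apply]
    simp [cellMatrix, T, mul_comm]
  have h2 : (cellMatrix L).det = (cellMatrix B).det * (T.det : ℝ) := by
    rw [h1, Matrix.det_mul, ← RingHom.mapMatrix_apply, ← RingHom.map_det]; rfl
  have h3 := det_cellMatrix_ne_zero_iff.2 hL
  have hB : (cellMatrix B).det ≠ 0 := fun h0 => h3 (by rw [h2, h0, zero_mul])
  have hT : T.det ≠ 0 := fun h0 => h3 (by rw [h2, h0, Int.cast_zero, mul_zero])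
  have hT1 : |T.det| ≤ 1 := by
    rw [h2, abs_mul] at hdet
    have := le_of_mul_le_mul_left (hdet.trans_eq (mul_one _).symm) (abs_pos.2 hB)
    exact_mod_cast this
  have hU : IsUnit T.det := by
    rw [Int.isUnit_iff_abs_eq]
    exact le_antisymm hT1 (Int.one_le_abs hT)
  have h4 : cellMatrix B = cellMatrix L * T⁻¹.map (Int.castRingHom ℝ) := by
    rw [h1, Matrix.mul_assoc, ← Matrix.map_mul, Matrix.mul_nonsing_inv _ hU]
    simp
  refine mem_lattice_iff.2 ⟨fun m => T⁻¹ m k, ?_⟩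
  ext i
  have h5 := congrFun (congrFun h4 i) k
  rw [Matrix.mul_apply] at h5
  simpa [cellMatrix, mul_comm] using h5.symm

namespace Crystal

variable {d : ℕ}

theorem mem_infinite_iff {M : Crystal d} {x : E3} {a : Feature d} :
    (x, a) ∈ M.infinite ↔ ∃ i, x - M.P i ∈ lattice M.L ∧ a = M.A i := by
  simp only [infinite, Set.mem_ofPred_eq, mem_lattice_iff]
  constructor
  · rintro ⟨i, k, h, h'⟩
    exact ⟨i, ⟨k, by rw [h]; simp⟩, h'⟩
  · rintro ⟨i, ⟨k, h⟩, h'⟩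
    exact ⟨i, k, by rw [h]; simp, h'⟩

theorem atom_mem_infinite (M : Crystal d) (i : Fin M.n) : (M.P i, M.A i) ∈ M.infinite :=
  mem_infinite_iff.2 ⟨i, by simp, rfl⟩

theorem feature_unique {M : Crystal d} {x : E3} {a a' : Feature d} (h : (x, a) ∈ M.infinite)
    (h' : (x, a') ∈ M.infinite) : a = a' := by
  obtain ⟨i, hi, rfl⟩ := mem_infinite_iff.1 h
  obtain ⟨j, hj, rfl⟩ := mem_infinite_iff.1 h'
  have : i = j := M.distinct i j (by simpa using sub_mem hj hi)
  rw [this]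

/-- The translations that preserve the infinite structure. -/
def translations (M : Crystal d) : Submodule ℤ E3 :=
  AddSubgroup.toIntSubmodule
    { carrier := {t | ∀ x a, (x + t, a) ∈ M.infinite ↔ (x, a) ∈ M.infinite}
      zero_mem' := fun x a => by rw [add_zero]
      add_mem' := fun {s t} hs ht x a => by rw [← add_assoc, ht, hs]
      neg_mem' := fun {t} ht x a => by rw [← ht, neg_add_cancel_right] }

theorem mem_translations {M : Crystal d} {t : E3} :
    t ∈ M.translations ↔ ∀ x a, (x + t, a) ∈ M.infinite ↔ (x, a) ∈ M.infinite := Iff.rfl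

theorem translations_congr {M M' : Crystal d} (h : M.infinite = M'.infinite) :
    M.translations = M'.translations := by
  ext t; rw [mem_translations, mem_translations, h]

theorem lattice_le_translations (M : Crystal d) : lattice M.L ≤ M.translations := by
  intro t ht
  rw [mem_translations]
  intro x a
  simp only [mem_infinite_iff]
  refine exists_congr fun i => and_congr_left fun _ => ?_
  rw [add_sub_right_comm]
  exact Submodule.add_mem_iff_left _ ht

/-- Pigeonhole: the translates of one atom by `0, t, …, n t` are `n + 1` points over `n` atoms of
the cell. Two of them differ by a lattice vector, which is a multiple of `t` by some number between
1 and `n`. The factorial serves all `t` at once. -/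
theorem factorial_smul_mem_lattice {M : Crystal d} {t : E3} (ht : t ∈ M.translations) :
    M.n.factorial • t ∈ lattice M.L := by
  let i₀ : Fin M.n := ⟨0, M.n_pos⟩
  have h1 : ∀ k : ℕ, ∃ i, M.P i₀ + k • t - M.P i ∈ lattice M.L := fun k => by
    have h2 : k • t ∈ M.translations := nsmul_mem ht k
    obtain ⟨i, hi, -⟩ := mem_infinite_iff.1
      ((mem_translations.1 h2 _ _).2 (M.atom_mem_infinite i₀))
    exact ⟨i, hi⟩
  choose c hc using h1
  obtain ⟨k, l, hkl, h2⟩ := Fintype.exists_ne_map_eq_of_card_lt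
    (fun k : Fin (M.n + 1) => c k) (by simp)
  wlog hlt : k < l generalizing k l
  · exact this l k hkl.symm h2.symm (lt_of_le_of_ne (not_lt.1 hlt) hkl.symm)
  have h3 : ((l : ℕ) - (k : ℕ)) • t ∈ lattice M.L := by
    have h4 := sub_mem (hc l) (hc k)
    rw [h2] at h4
    have h5 : (l : ℕ) • t = ((l : ℕ) - (k : ℕ)) • t + (k : ℕ) • t := by
      rw [← add_smul, Nat.sub_add_cancel (le_of_lt hlt)]
    rw [h5] at h4
    simpa [add_sub_add_left_eq_sub] using h4
  obtain ⟨q, hq⟩ : (l : ℕ) - (k : ℕ) ∣ M.n.factorial :=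
    Nat.dvd_factorial (Nat.sub_pos_of_lt hlt) (by omega)
  rw [hq, mul_comm, mul_smul]
  exact nsmul_mem h3 q

/-- The translations lie between the lattice of `M` and the same lattice scaled by `1 / n!`. -/
theorem exists_lattice_eq_translations (M : Crystal d) :
    ∃ B : Fin 3 → E3, lattice B = M.translations := by
  have hN : (M.n.factorial : ℝ) ≠ 0 := by exact_mod_cast M.n.factorial_ne_zero
  have hL' : LinearIndependent ℝ fun k => (M.n.factorial : ℝ)⁻¹ • M.L k :=
    M.linInd.units_smul fun _ => (Units.mk0 _ hN)⁻¹
  refine exists_lattice_eq M.linInd hL' M.lattice_le_translations fun t ht => ?_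
  obtain ⟨k, hk⟩ := mem_lattice_iff.1 (factorial_smul_mem_lattice ht)
  refine mem_lattice_iff.2 ⟨k, ?_⟩
  rw [← Nat.cast_smul_eq_nsmul ℝ] at hk
  have h1 := congrArg ((M.n.factorial : ℝ)⁻¹ • ·) hk
  simp only [smul_smul, inv_mul_cancel₀ hN, one_smul, Finset.smul_sum] at h1
  rw [← h1]
  exact Finset.sum_congr rfl fun m _ => by rw [smul_smul, mul_comm]

/-- Every infinite structure has a representation whose lattice consists of all its
translations. -/
theorem exists_infinite_eq_lattice_eq_translations (M : Crystal d) :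
    ∃ M' : Crystal d, M'.infinite = M.infinite ∧ lattice M'.L = M.translations := by
  classical
  obtain ⟨B, hB⟩ := M.exists_lattice_eq_translations
  -- The primitive description keeps one atom from each class modulo all translations.
  let S : Setoid (Fin M.n) :=
    { r := fun i j => M.P i - M.P j ∈ M.translations
      iseqv := ⟨fun i => by simp, fun {i j} h => by simpa using neg_mem h,
        fun {i j k} h h' => by simpa using add_mem h h'⟩ }
  have hS : ∀ {i j}, S i j ↔ M.P i - M.P j ∈ M.translations := Iff.rfl
  let q := (Fintype.equivFin (Quotient S)).symm
  let c : Fin (Fintype.card (Quotient S)) → Fin M.n := fun k => (q k).out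
  let M' : Crystal d :=
    { n := Fintype.card (Quotient S)
      A := fun k => M.A (c k)
      P := fun k => M.P (c k)
      L := B
      n_pos := Fintype.card_pos_iff.2 ⟨Quotient.mk S ⟨0, M.n_pos⟩⟩
      linInd := linearIndependent_of_lattice_le M.linInd
        (M.lattice_le_translations.trans hB.ge)
      distinct := fun k l h => by
        rw [hB] at h
        exact q.injective (Quotient.out_equiv_out.1 (hS.2 h)) }
  refine ⟨M', ?_, hB⟩
  ext ⟨x, a⟩
  constructor
  · intro h
    obtain ⟨k, hk, rfl⟩ := mem_infinite_iff.1 h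
    have h1 : x - M.P (c k) ∈ M.translations := hB ▸ hk
    have h2 := (mem_translations.1 h1 _ _).2 (M.atom_mem_infinite (c k))
    rwa [add_sub_cancel] at h2
  · intro h
    obtain ⟨i, hi, rfl⟩ := mem_infinite_iff.1 h
    obtain ⟨k, hk⟩ := q.surjective (Quotient.mk S i)
    have h1 : M.P (c k) - M.P i ∈ M.translations := by
      rw [← hS]
      exact Quotient.exact (by simp [c, hk])
    have h2 : x - M.P (c k) ∈ M.translations := by
      simpa using sub_mem (M.lattice_le_translations hi) h1
    refine mem_infinite_iff.2 ⟨k, ?_, ?_⟩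
    · rw [← hB] at h2; exact h2
    · have h3 := (mem_translations.1 h2 _ _).2 (M.atom_mem_infinite (c k))
      rw [add_sub_cancel] at h3
      exact feature_unique h h3

theorem IsMinimal.lattice_eq_translations {M : Crystal d} (h : M.IsMinimal) :
    lattice M.L = M.translations := by
  obtain ⟨M', h1, h2⟩ := M.exists_infinite_eq_lattice_eq_translations
  rw [← h2]
  exact lattice_eq_of_abs_det_le M.linInd (h2 ▸ M.lattice_le_translations) (h M' h1)

/-- The atoms of a cell represent the lattice classes of occupied points, each class once by
`distinct`. The same structure and the same lattice therefore give the same classes. -/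
theorem exists_equiv_of_infinite_eq {M M' : Crystal d} (h : M.infinite = M'.infinite)
    (hL : lattice M.L = lattice M'.L) : ∃ e : Fin M.n ≃ Fin M'.n, ∀ i,
      M'.A (e i) = M.A i ∧ M'.P (e i) - M.P i ∈ lattice M'.L := by
  have key : ∀ {M M' : Crystal d}, M.infinite = M'.infinite → ∀ i, ∃ j,
      M.P i - M'.P j ∈ lattice M'.L ∧ M.A i = M'.A j := fun {M M'} h i =>
    mem_infinite_iff.1 (h ▸ M.atom_mem_infinite i)
  choose f hf using key h
  choose g hg using key h.symm
  refine ⟨⟨f, g, fun i => ?_, fun j => ?_⟩, fun i => ⟨(hf i).2.symm, ?_⟩⟩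
  · apply M.distinct
    have h1 := (hg (f i)).1
    have h2 := (hf i).1
    rw [← hL] at h2
    simpa using neg_mem (add_mem h2 h1)
  · apply M'.distinct
    have h1 := (hg j).1
    have h2 := (hf (g j)).1
    rw [hL] at h1
    simpa using neg_mem (add_mem h1 h2)
  · simpa using neg_mem (hf i).1

end Crystal

/-! ### Fractional coordinates and rotations -/

theorem frac_add (B : Fin 3 → E3) (x y : E3) : frac B (x + y) = frac B x + frac B y := by
  simp [frac, Matrix.mulVec_add]

theorem frac_sub (B : Fin 3 → E3) (x y : E3) : frac B (x - y) = frac B x - frac B y := by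
  simp [frac, Matrix.mulVec_sub]

theorem frac_sum_smul {B : Fin 3 → E3} (h : (cellMatrix B).det ≠ 0) (x : Fin 3 → ℝ) :
    frac B (∑ k, x k • B k) = x := by
  rw [frac, ← cellMatrix_mulVec, Matrix.mulVec_mulVec,
    Matrix.nonsing_inv_mul _ (isUnit_iff_ne_zero.2 h), Matrix.one_mulVec]

theorem exists_int_frac_eq {B : Fin 3 → E3} (h : (cellMatrix B).det ≠ 0) {t : E3}
    (ht : t ∈ lattice B) (k : Fin 3) : ∃ m : ℤ, frac B t k = m := by
  obtain ⟨n, rfl⟩ := mem_lattice_iff.1 ht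
  exact ⟨n k, congrFun (frac_sum_smul h _) k⟩

section Rotation

variable (R : Matrix.specialOrthogonalGroup (Fin 3) ℝ)

theorem rot_ofLp (x : E3) :
    (rot R x).ofLp = (R : Matrix (Fin 3) (Fin 3) ℝ).mulVec x.ofLp := rfl

theorem transpose_mul_self : (R : Matrix (Fin 3) (Fin 3) ℝ).transpose * R = 1 :=
  ((Matrix.mem_orthogonalGroup_iff' _ _).1 (Matrix.mem_specialOrthogonalGroup_iff.1 R.2).1)

theorem det_rotation : (R : Matrix (Fin 3) (Fin 3) ℝ).det = 1 :=
  (Matrix.mem_specialOrthogonalGroup_iff.1 R.2).2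

theorem inner_rot (x y : E3) : inner ℝ (rot R x) (rot R y) = inner ℝ x y := by
  simp only [EuclideanSpace.inner_eq_star_dotProduct, rot_ofLp, star_trivial]
  rw [Matrix.dotProduct_mulVec, ← Matrix.mulVec_transpose, Matrix.mulVec_mulVec,
    transpose_mul_self, Matrix.one_mulVec]

theorem norm_rot (x : E3) : ‖rot R x‖ = ‖x‖ := by
  rw [@norm_eq_sqrt_real_inner E3, @norm_eq_sqrt_real_inner E3, inner_rot]

/-- A rotation as a linear equivalence. -/
def rotEquiv : E3 ≃ₗ[ℝ] E3 := LinearEquiv.ofInjectiveEndo (rot R) (rot_injective R)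

@[simp] theorem rotEquiv_apply (x : E3) : rotEquiv R x = rot R x := rfl

theorem det_rot : LinearMap.det (rot R) = 1 := by
  have : rot R = Matrix.toLin (PiLp.basisFun 2 ℝ (Fin 3)) (PiLp.basisFun 2 ℝ (Fin 3)) R := by
    rw [← Matrix.toLpLin_eq_toLin]; rfl
  rw [this, LinearMap.det_toLin, det_rotation]

theorem cellMatrix_rot (B : Fin 3 → E3) :
    cellMatrix (fun k => rot R (B k)) = (R : Matrix (Fin 3) (Fin 3) ℝ) * cellMatrix B := by
  ext i k
  simp [cellMatrix, Matrix.mul_apply, rot_ofLp, Matrix.mulVec, dotProduct]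

theorem det_cellMatrix_rot (B : Fin 3 → E3) :
    (cellMatrix fun k => rot R (B k)).det = (cellMatrix B).det := by
  rw [cellMatrix_rot, Matrix.det_mul, det_rotation, one_mul]

theorem frac_rot (B : Fin 3 → E3) (x : E3) :
    frac (fun k => rot R (B k)) (rot R x) = frac B x := by
  rw [frac, cellMatrix_rot, Matrix.mul_inv_rev, rot_ofLp, Matrix.mulVec_mulVec, Matrix.mul_assoc,
    Matrix.nonsing_inv_mul _ (by rw [det_rotation]; exact isUnit_one), Matrix.mul_one, frac]

theorem dot_rot (B : Fin 3 → E3) (i j : Fin 3) :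
    dot (fun k => rot R (B k)) i j = dot B i j := inner_rot R _ _

theorem angle_rot (x y : E3) :
    InnerProductGeometry.angle (rot R x) (rot R y) = InnerProductGeometry.angle x y := by
  simp only [InnerProductGeometry.angle, inner_rot, norm_rot]

theorem rot_mem_lattice_iff {B : Fin 3 → E3} {x : E3} :
    rot R x ∈ lattice (fun k => rot R (B k)) ↔ x ∈ lattice B := by
  refine ⟨mem_lattice_rot R B x, fun h => ?_⟩
  obtain ⟨k, rfl⟩ := mem_lattice_iff.1 h
  exact mem_lattice_iff.2 ⟨k, by simp⟩

theorem lattice_rot (B : Fin 3 → E3) :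
    lattice (fun k => rot R (B k)) = (lattice B).map ((rot R).restrictScalars ℤ) := by
  ext x
  obtain ⟨x, rfl⟩ := (rotEquiv R).surjective x
  rw [rotEquiv_apply, rot_mem_lattice_iff, Submodule.mem_map]
  refine ⟨fun h => ⟨x, h, rfl⟩, ?_⟩
  rintro ⟨y, hy, hxy⟩
  rwa [← rot_injective R hxy]

theorem isNiggliBasis_rot_iff {L B : Fin 3 → E3} :
    IsNiggliBasis (fun k => rot R (L k)) (fun k => rot R (B k)) ↔ IsNiggliBasis L B := by
  have h : lattice (fun k => rot R (B k)) = lattice (fun k => rot R (L k)) ↔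
      lattice B = lattice L := by
    rw [lattice_rot, lattice_rot]
    exact (Submodule.map_injective_of_injective (f := (rot R).restrictScalars ℤ)
      (rot_injective R)).eq_iff
  simp only [IsNiggliBasis, NiggliCommon, NiggliTypeI, NiggliTypeII, dot_rot, det_cellMatrix_rot, h]

theorem latticeTokens_rot (B : Fin 3 → E3) :
    latticeTokens (fun k => rot R (B k)) = latticeTokens B := by
  simp only [latticeTokens, norm_rot, angle_rot]

/-- The rigid motion `x ↦ R x + b`. -/
def motion (b : E3) : E3 ≃ᵃ[ℝ] E3 :=
  (rotEquiv R).toAffineEquiv.trans (AffineEquiv.constVAdd ℝ E3 b)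

variable {R}

theorem motion_apply (b x : E3) : motion R b x = rot R x + b := by
  simp [motion, add_comm]

theorem motion_linear (b : E3) : (motion R b).linear = rotEquiv R := by
  ext x : 1
  rfl

theorem motion_sub (b x y : E3) : motion R b x - motion R b y = rot R (x - y) := by
  rw [motion_apply, motion_apply, map_sub, add_sub_add_right_eq_sub]

theorem isometry_motion (b : E3) : Isometry (motion R b) :=
  Isometry.of_dist_eq fun x y => by rw [dist_eq_norm, motion_sub, norm_rot, dist_eq_norm]

end Rotation

variable {d : ℕ}

/-! ### Congruent descriptions -/

/-- The rotation `R` together with the matching `e` of atoms carries the description `M` to the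
description `M'`, up to a common translation and up to lattice translations of single atoms. -/
structure IsCongruence (M M' : Crystal d) (R : Matrix.specialOrthogonalGroup (Fin 3) ℝ)
    (e : Fin M.n ≃ Fin M'.n) : Prop where
  feature : ∀ i, M'.A (e i) = M.A i
  lattice_eq : lattice M'.L = lattice fun k => rot R (M.L k)
  position : ∀ i j, (M'.P (e i) - rot R (M.P i)) - (M'.P (e j) - rot R (M.P j)) ∈ lattice M'.L

namespace IsCongruence

variable {M M' : Crystal d} {R : Matrix.specialOrthogonalGroup (Fin 3) ℝ}
  {e : Fin M.n ≃ Fin M'.n}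

/-- The rigid motion that takes atom `i` to the matched atom. -/
def atomMotion (M M' : Crystal d) (R : Matrix.specialOrthogonalGroup (Fin 3) ℝ)
    (e : Fin M.n ≃ Fin M'.n) (i : Fin M.n) : E3 ≃ᵃ[ℝ] E3 :=
  motion R (M'.P (e i) - rot R (M.P i))

theorem atomMotion_self (M M' : Crystal d) (R : Matrix.specialOrthogonalGroup (Fin 3) ℝ)
    (e : Fin M.n ≃ Fin M'.n) (i : Fin M.n) : atomMotion M M' R e i (M.P i) = M'.P (e i) := by
  rw [atomMotion, motion_apply, add_sub_cancel]

/-- By `position`, the translation parts for two atoms differ by a lattice vector. Each single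
motion thus carries the whole infinite structure over, and the atom may be picked to suit the
quantity compared. -/
theorem atomMotion_sub_mem (h : IsCongruence M M' R e) (i j : Fin M.n) (x : E3) :
    atomMotion M M' R e i x - atomMotion M M' R e j x ∈ lattice M'.L := by
  rw [atomMotion, atomMotion, motion_apply, motion_apply, add_sub_add_left_eq_sub]
  exact h.position i j

theorem atomMotion_mem_infinite (h : IsCongruence M M' R e) (i : Fin M.n) (x : E3) (a : Feature d) :
    (atomMotion M M' R e i x, a) ∈ M'.infinite ↔ (x, a) ∈ M.infinite := by
  rw [Crystal.mem_infinite_iff, Crystal.mem_infinite_iff, ← e.exists_congr_right]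
  refine exists_congr fun j => ?_
  rw [h.feature]
  refine and_congr_left fun _ => ?_
  have h1 : atomMotion M M' R e i x - M'.P (e j) = rot R (x - M.P j) +
      (atomMotion M M' R e i (M.P j) - atomMotion M M' R e j (M.P j)) := by
    rw [← atomMotion_self M M' R e j, ← motion_sub (M'.P (e i) - rot R (M.P i))]
    simp only [atomMotion]
    abel
  rw [h1, Submodule.add_mem_iff_left _ (h.atomMotion_sub_mem i j _), h.lattice_eq,
    rot_mem_lattice_iff]

/-! ### Space groups of congruent descriptions -/

theorem conj_mem_spaceGroup_iff (h : IsCongruence M M' R e) (i : Fin M.n) (g : E3 ≃ᵃ[ℝ] E3) :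
    MulAut.conj (atomMotion M M' R e i) g ∈ spaceGroup M' ↔ g ∈ spaceGroup M := by
  set γ := atomMotion M M' R e i
  have hγ : Isometry γ := isometry_motion _
  have hγ' : Isometry ⇑(γ⁻¹) := hγ.right_inv fun x => γ.apply_symm_apply x
  have hc : ∀ x, MulAut.conj γ g (γ x) = γ (g x) := fun x => by
    change γ (g (γ.symm (γ x))) = _
    rw [γ.symm_apply_apply]
  have hinf := h.atomMotion_mem_infinite i
  constructor
  · rintro ⟨h1, h2⟩
    refine ⟨?_, fun p a => ?_⟩
    · have h3 : ⇑g = ⇑(γ⁻¹) ∘ ⇑(MulAut.conj γ g) ∘ ⇑γ := by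
        ext x : 1
        change g x = γ.symm (MulAut.conj γ g (γ x))
        rw [hc, γ.symm_apply_apply]
      rw [h3]
      exact hγ'.comp (h1.comp hγ)
    · rw [← hinf, ← hinf p, ← h2 (γ p), hc]
  · rintro ⟨h1, h2⟩
    refine ⟨hγ.comp (h1.comp hγ'), fun p a => ?_⟩
    obtain ⟨x, rfl⟩ := γ.surjective p
    rw [hc, hinf, hinf, h2]

theorem exists_conj_eq (h : IsCongruence M M' R e) (i : Fin M.n) {g' : E3 ≃ᵃ[ℝ] E3} (hg' : g' ∈ spaceGroup M') :
    ∃ g ∈ spaceGroup M, MulAut.conj (atomMotion M M' R e i) g = g' := by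
  obtain ⟨g, rfl⟩ := (MulAut.conj (atomMotion M M' R e i)).surjective g'
  exact ⟨g, (h.conj_mem_spaceGroup_iff i g).1 hg', rfl⟩

theorem spaceGroup_eq_map (h : IsCongruence M M' R e) (i : Fin M.n) :
    spaceGroup M' = (spaceGroup M).map (MulAut.conj (atomMotion M M' R e i)).toMonoidHom := by
  ext g'
  rw [Subgroup.mem_map]
  constructor
  · exact fun hg' => h.exists_conj_eq i hg'
  · rintro ⟨g, hg, rfl⟩
    exact (h.conj_mem_spaceGroup_iff i g).2 hg

/-- The space groups are conjugate by a motion whose linear part has determinant one, and composing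
with it preserves orientation in both directions. -/
theorem spaceGroupType_eq (h : IsCongruence M M' R e) : spaceGroupType M' = spaceGroupType M := by
  let i : Fin M.n := ⟨0, M.n_pos⟩
  let γ := atomMotion M M' R e i
  have hdet : LinearMap.det (γ.linear : E3 →ₗ[ℝ] E3) = 1 := by
    have h1 : (γ.linear : E3 →ₗ[ℝ] E3) = rot R := by
      ext x : 1
      exact congrArg (· x) (motion_linear (R := R) (M'.P (e i) - rot R (M.P i)))
    rw [h1, det_rot]
  have hmul : ∀ φ ψ : E3 ≃ᵃ[ℝ] E3, LinearMap.det ((φ * ψ).linear : E3 →ₗ[ℝ] E3) =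
      LinearMap.det (φ.linear : E3 →ₗ[ℝ] E3) * LinearMap.det (ψ.linear : E3 →ₗ[ℝ] E3) :=
    fun φ ψ => LinearMap.det_comp _ _
  have hconj : ∀ φ ψ : E3 ≃ᵃ[ℝ] E3, ∀ G : Subgroup (E3 ≃ᵃ[ℝ] E3),
      (G.map (MulAut.conj ψ).toMonoidHom).map (MulAut.conj φ).toMonoidHom =
        G.map (MulAut.conj (φ * ψ)).toMonoidHom := fun φ ψ G => by
    rw [Subgroup.map_map, map_mul]; rfl
  have hM : spaceGroup M' = (spaceGroup M).map (MulAut.conj γ).toMonoidHom :=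
    h.spaceGroup_eq_map i
  ext H
  constructor
  · rintro ⟨φ, hφ, rfl⟩
    exact ⟨φ * γ, by rwa [hmul, hdet, mul_one], by rw [hM, hconj]⟩
  · rintro ⟨φ, hφ, rfl⟩
    refine ⟨φ * γ⁻¹, ?_, by rw [hM, hconj, inv_mul_cancel_right]⟩
    have h1 := hmul (φ * γ⁻¹) γ
    rw [inv_mul_cancel_right, hdet, mul_one] at h1
    rwa [← h1]

/-! ### Choices and unit cells of congruent descriptions -/

theorem isNiggliBasis_iff (h : IsCongruence M M' R e) {B : Fin 3 → E3} :
    IsNiggliBasis M'.L (fun k => rot R (B k)) ↔ IsNiggliBasis M.L B := by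
  rw [← isNiggliBasis_rot_iff R (L := M.L), IsNiggliBasis, h.lattice_eq]; rfl

/-- The motion of atom `i`, acting on atoms with features. -/
def atomMap (M M' : Crystal d) (R : Matrix.specialOrthogonalGroup (Fin 3) ℝ)
    (e : Fin M.n ≃ Fin M'.n) (i : Fin M.n) (s : E3 × Feature d) : E3 × Feature d :=
  (atomMotion M M' R e i s.1, s.2)

theorem atomMap_injective (i : Fin M.n) : Function.Injective (atomMap M M' R e i) := by
  rintro ⟨x, a⟩ ⟨y, b⟩ hxy
  simpa [atomMap] using hxy

theorem atomMap_surjective (i : Fin M.n) : Function.Surjective (atomMap M M' R e i) := by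
  rintro ⟨x, a⟩
  exact ⟨((atomMotion M M' R e i).symm x, a), by simp [atomMap]⟩

theorem atomMap_mem_neighbors_iff (h : IsCongruence M M' R e) (r : ℝ) (i : Fin M.n) (s : E3 × Feature d) :
    atomMap M M' R e i s ∈ neighbors M' r (e i) ↔ s ∈ neighbors M r i := by
  simp only [neighbors, atomMap, Set.mem_ofPred_eq, h.atomMotion_mem_infinite,
    ← atomMotion_self M M' R e i, (atomMotion M M' R e i).injective.ne_iff]
  rw [atomMotion, (isometry_motion _).dist_eq]

theorem finsum_atomMap (Z : Feature d → ℕ) (i : Fin M.n) {S S' : Set (E3 × Feature d)}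
    (hS : ∀ s, atomMap M M' R e i s ∈ S' ↔ s ∈ S) :
    ∑ᶠ s ∈ S', Z s.2 = ∑ᶠ s ∈ S, Z s.2 := by
  have : S' = atomMap M M' R e i '' S := by
    ext s'
    obtain ⟨s, rfl⟩ := atomMap_surjective (M := M) (M' := M') (R := R) (e := e) i s'
    rw [hS, (atomMap_injective i).mem_set_image]
  rw [this, finsum_mem_image (atomMap_injective i).injOn]
  rfl

theorem localDensity_eq (h : IsCongruence M M' R e) (Z : Feature d → ℕ) (r : ℝ) (i : Fin M.n) :
    localDensity Z r M' (e i) = localDensity Z r M i :=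
  finsum_atomMap Z i (h.atomMap_mem_neighbors_iff r i)

theorem directionalDensity_eq (h : IsCongruence M M' R e) (Z : Feature d → ℕ) (r : ℝ) (B : Fin 3 → E3) (k : Fin 3)
    (i : Fin M.n) : directionalDensity Z r M' (fun k => rot R (B k)) k (e i) =
      directionalDensity Z r M B k i := by
  refine finsum_atomMap Z i fun s => and_congr (h.atomMap_mem_neighbors_iff r i s) ?_
  rw [atomMap, ← sub_pos, ← sub_pos (b := frac B (M.P i) k), ← Pi.sub_apply, ← Pi.sub_apply,
    ← frac_sub, ← frac_sub, ← atomMotion_self M M' R e i, atomMotion, motion_sub, frac_rot]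

theorem originKey_eq (h : IsCongruence M M' R e) (Z : Feature d → ℕ) (r : ℝ) (B : Fin 3 → E3) (i : Fin M.n) :
    originKey Z r M' (fun k => rot R (B k)) (e i) = originKey Z r M B i := by
  simp only [originKey, h.feature, h.localDensity_eq, h.directionalDensity_eq]

theorem isChoice_iff (h : IsCongruence M M' R e) {Z : Feature d → ℕ} {r : ℝ} {B : Fin 3 → E3} {o : Fin M.n} :
    IsChoice Z r M' (fun k => rot R (B k)) (e o) ↔ IsChoice Z r M B o := by
  rw [IsChoice, h.isNiggliBasis_iff, ← e.forall_congr_right, IsChoice]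
  simp only [h.originKey_eq]

/-- Every frame is the rotation of a frame and every atom is matched, so nothing is lost by
transporting choices. The predicate `p` stays arbitrary in order to serve unit cells and sequences
alike. -/
theorem exists_isChoice_iff (h : IsCongruence M M' R e) {Z : Feature d → ℕ} {r : ℝ}
    {p : (Fin 3 → E3) → Fin M'.n → Prop} :
    (∃ B o, IsChoice Z r M' B o ∧ p B o) ↔
      ∃ B o, IsChoice Z r M B o ∧ p (fun k => rot R (B k)) (e o) := by
  constructor
  · rintro ⟨B', o', h1, h2⟩
    obtain ⟨o, rfl⟩ := e.surjective o'
    obtain ⟨B, rfl⟩ : ∃ B : Fin 3 → E3, (fun k => rot R (B k)) = B' :=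
      ⟨fun k => (rotEquiv R).symm (B' k), funext fun k => (rotEquiv R).apply_symm_apply _⟩
    exact ⟨B, o, h.isChoice_iff.1 h1, h2⟩
  · rintro ⟨B, o, h1, h2⟩
    exact ⟨_, _, h.isChoice_iff.2 h1, h2⟩

/-- The two differences of positions agree, after rotation, up to a lattice vector. Its coordinates
in a basis of the lattice are integers, which `Int.fract` discards. -/
theorem cellFrac_eq (h : IsCongruence M M' R e) {B : Fin 3 → E3} (hB : IsNiggliBasis M.L B) (o j : Fin M.n) :
    cellFrac M' (fun k => rot R (B k)) (e o) (e j) = cellFrac M B o j := by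
  have hB' := h.isNiggliBasis_iff.2 hB
  ext k
  have h1 := h.atomMotion_sub_mem j o (M.P j)
  rw [← hB'.1] at h1
  obtain ⟨m, hm⟩ := exists_int_frac_eq hB'.2.1.ne' h1 k
  have h2 : M'.P (e j) - M'.P (e o) = rot R (M.P j - M.P o) +
      (atomMotion M M' R e j (M.P j) - atomMotion M M' R e o (M.P j)) := by
    rw [← atomMotion_self M M' R e j, ← atomMotion_self M M' R e o,
      ← motion_sub (M'.P (e o) - rot R (M.P o))]
    simp only [atomMotion]
    abel
  rw [cellFrac, cellFrac, ← Pi.sub_apply, ← Pi.sub_apply, ← frac_sub, ← frac_sub, h2, frac_add,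
    frac_rot, Pi.add_apply, hm, Int.fract_add_intCast]

theorem unitCellOf_eq (h : IsCongruence M M' R e) {B : Fin 3 → E3} (hB : IsNiggliBasis M.L B) (o : Fin M.n) :
    unitCellOf M' (fun k => rot R (B k)) (e o) = (unitCellOf M B o).rotate R := by
  unfold unitCellOf UnitCell.rotate
  congr 1
  rw [← Set.range_comp, ← e.surjective.range_comp]
  congr 1
  ext1 j
  simp only [Function.comp_apply, h.cellFrac_eq hB, h.feature, map_sum, map_smul]

theorem unitCells_eq (h : IsCongruence M M' R e) (Z : Feature d → ℕ) (r : ℝ) :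
    unitCells Z r M' = UnitCell.rotate R '' unitCells Z r M := by
  ext U
  rw [unitCells, Set.mem_ofPred_eq, h.exists_isChoice_iff]
  constructor
  · rintro ⟨B, o, h1, rfl⟩
    exact ⟨_, ⟨B, o, h1, rfl⟩, (h.unitCellOf_eq h1.1 o).symm⟩
  · rintro ⟨_, ⟨B, o, h1, rfl⟩, rfl⟩
    exact ⟨B, o, h1, (h.unitCellOf_eq h1.1 o).symm⟩

/-! ### Symmetries, irreducible atoms and sequences of congruent descriptions -/

theorem fracSymmetries_eq (h : IsCongruence M M' R e) (B : Fin 3 → E3) (o : Fin M.n) :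
    fracSymmetries M' (fun k => rot R (B k)) (e o) = fracSymmetries M B o := by
  -- The motion of the origin atom itself matches the two origins exactly, so translation parts
  -- agree even before reduction modulo one.
  set γ := atomMotion M M' R e o with hγ
  have hlin : ∀ v, γ.linear v = rot R v := fun v =>
    congrArg (· v) (motion_linear (R := R) (M'.P (e o) - rot R (M.P o)))
  have h1 : ∀ (g : E3 ≃ᵃ[ℝ] E3) (v : E3),
      (MulAut.conj γ g).linear (rot R v) = rot R (g.linear v) := fun g v => by
    change γ.linear (g.linear (γ.linear.symm (rot R v))) = _
    rw [← hlin v, LinearEquiv.symm_apply_apply, hlin]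
  have h2 : ∀ g : E3 ≃ᵃ[ℝ] E3, MulAut.conj γ g (M'.P (e o)) - M'.P (e o) =
      rot R (g (M.P o) - M.P o) := fun g => by
    rw [← atomMotion_self M M' R e o, ← motion_sub (M'.P (e o) - rot R (M.P o))]
    change γ (g (γ.symm (γ (M.P o)))) - _ = _
    rw [γ.symm_apply_apply]
    rfl
  ext T
  constructor
  · rintro ⟨g', hg', h3, h4⟩
    obtain ⟨g, hg, rfl⟩ := h.exists_conj_eq o hg'
    simp only [← hγ, h1, h2, frac_rot] at h3 h4
    exact ⟨g, hg, h3, h4⟩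
  · rintro ⟨g, hg, h3, h4⟩
    refine ⟨_, (h.conj_mem_spaceGroup_iff o g).2 hg, ?_, ?_⟩
    · simpa only [← hγ, h1, frac_rot] using h3
    · simpa only [← hγ, h2, frac_rot] using h4

theorem constVAdd_mem_spaceGroup {t : E3} (ht : t ∈ lattice M.L) :
    AffineEquiv.constVAdd ℝ E3 t ∈ spaceGroup M := by
  refine ⟨Isometry.of_dist_eq fun x y => by simp, fun p a => ?_⟩
  rw [AffineEquiv.constVAdd_apply, vadd_eq_add, add_comm]
  exact Crystal.mem_translations.1 (M.lattice_le_translations ht) p a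

theorem atomEquiv_iff (h : IsCongruence M M' R e) (i j : Fin M.n) : AtomEquiv M' (e i) (e j) ↔ AtomEquiv M i j := by
  set γ := atomMotion M M' R e i with hγ
  have hi : γ (M.P i) = M'.P (e i) := atomMotion_self M M' R e i
  have ht : M'.P (e j) - γ (M.P j) ∈ lattice M'.L := by
    rw [← atomMotion_self M M' R e j]; exact h.atomMotion_sub_mem j i _
  have hT := constVAdd_mem_spaceGroup ht
  -- The motion of atom `i` takes atom `j` to its partner only up to a lattice vector. The symmetry
  -- `T` corrects this.
  set T := AffineEquiv.constVAdd ℝ E3 (M'.P (e j) - γ (M.P j)) with hTdef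
  have hTj : T (γ (M.P j)) = M'.P (e j) := by simp [hTdef]
  have hc : ∀ g : E3 ≃ᵃ[ℝ] E3, MulAut.conj γ g (M'.P (e i)) = γ (g (M.P i)) := fun g => by
    rw [← hi]
    change γ (g (γ.symm (γ (M.P i)))) = _
    rw [γ.symm_apply_apply]
  constructor
  · rintro ⟨g', hg', h1⟩
    obtain ⟨g, hg, h2⟩ := h.exists_conj_eq i (mul_mem (inv_mem hT) hg')
    refine ⟨g, hg, γ.injective ?_⟩
    rw [← hc, h2]
    change T.symm (g' _) = _
    rw [h1, ← hTj, T.symm_apply_apply]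
  · rintro ⟨g, hg, h1⟩
    refine ⟨T * MulAut.conj γ g, mul_mem hT ((h.conj_mem_spaceGroup_iff i g).2 hg), ?_⟩
    change T (MulAut.conj γ g _) = _
    rw [hc, h1, hTj]

theorem multiplicity_eq (h : IsCongruence M M' R e) (i : Fin M.n) : multiplicity M' (e i) = multiplicity M i := by
  classical
  refine (Finset.card_equiv e fun j => ?_).symm
  simp [h.atomEquiv_iff]

theorem atomKey_eq (h : IsCongruence M M' R e) (Z : Feature d → ℕ) {B : Fin 3 → E3} (hB : IsNiggliBasis M.L B)
    (o i : Fin M.n) : atomKey Z M' (fun k => rot R (B k)) (e o) (e i) = atomKey Z M B o i := by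
  simp only [atomKey, h.feature, h.multiplicity_eq, h.cellFrac_eq hB]

theorem mem_irreducibleAtoms_iff (h : IsCongruence M M' R e) {B : Fin 3 → E3} (hB : IsNiggliBasis M.L B) (o i : Fin M.n) :
    e i ∈ irreducibleAtoms M' (fun k => rot R (B k)) (e o) ↔ i ∈ irreducibleAtoms M B o := by
  simp only [irreducibleAtoms, Finset.mem_filter, Finset.mem_univ, true_and]
  rw [← e.forall_congr_right]
  simp only [h.atomEquiv_iff, h.cellFrac_eq hB]

theorem atomTokens_eq (h : IsCongruence M M' R e) (Z : Feature d → ℕ) {B : Fin 3 → E3} (hB : IsNiggliBasis M.L B)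
    (o : Fin M.n) : atomTokens Z M' (fun k => rot R (B k)) (e o) = atomTokens Z M B o := by
  unfold atomTokens
  congr 2
  ext t
  simp only [Finset.mem_image]
  rw [← e.exists_congr_right]
  simp only [h.mem_irreducibleAtoms_iff hB, h.atomKey_eq Z hB]

theorem compositionTokens_eq (h : IsCongruence M M' R e) (Z : Feature d → ℕ) :
    compositionTokens Z M' = compositionTokens Z M := by
  have h1 : M'.n = M.n := by simpa using (Fintype.card_congr e).symm
  have h2 : (Finset.univ.image fun i => Z (M'.A i)) = Finset.univ.image fun i => Z (M.A i) := by
    ext z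
    simp only [Finset.mem_image, Finset.mem_univ, true_and]
    rw [← e.exists_congr_right]
    simp only [h.feature]
  have h3 : ∀ z, (Finset.univ.filter fun i => Z (M'.A i) = z).card =
      (Finset.univ.filter fun i => Z (M.A i) = z).card := fun z =>
    (Finset.card_equiv e fun j => by simp [h.feature]).symm
  simp only [compositionTokens, h1, h2, h3]

theorem sequenceOf_eq (h : IsCongruence M M' R e) (Z : Feature d → ℕ) {B : Fin 3 → E3} (hB : IsNiggliBasis M.L B)
    (o : Fin M.n) : sequenceOf Z M' (fun k => rot R (B k)) (e o) = sequenceOf Z M B o := by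
  simp only [sequenceOf, h.compositionTokens_eq, h.spaceGroupType_eq, h.fracSymmetries_eq,
    latticeTokens_rot, h.atomTokens_eq Z hB]

theorem admissibleSequences_eq (h : IsCongruence M M' R e) (Z : Feature d → ℕ) (r : ℝ) :
    admissibleSequences Z r M' = admissibleSequences Z r M := by
  ext s
  rw [admissibleSequences, Set.mem_ofPred_eq, h.exists_isChoice_iff]
  refine exists_congr fun B => exists_congr fun o => and_congr_right fun h1 => ?_
  rw [h.sequenceOf_eq Z h1.1]

end IsCongruence

/-! ### Rigid motions and minimum representations as congruences -/

theorem isCongruence_rigid (M : Crystal d) (R : Matrix.specialOrthogonalGroup (Fin 3) ℝ) (b : E3) :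
    IsCongruence M (M.rigid R b) R (Equiv.refl _) where
  feature _ := rfl
  lattice_eq := rfl
  position i j := by
    change rot R (M.P i) + b - rot R (M.P i) - (rot R (M.P j) + b - rot R (M.P j)) ∈ _
    simp

theorem rot_one (x : E3) : rot 1 x = x := by
  apply WithLp.ofLp_injective
  rw [rot_ofLp]; simp

theorem rotate_one (U : UnitCell d) : U.rotate 1 = U := by
  simp [UnitCell.rotate, rot_one]

/-- Both lattices consist of all translations of the common structure, so they coincide, and the
atoms match up to lattice vectors without any rotation. -/
theorem exists_isCongruence_one {M M' : Crystal d} (hM : M.IsMinimal) (hM' : M'.IsMinimal)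
    (h : M.infinite = M'.infinite) : ∃ e, IsCongruence M M' 1 e := by
  have hL : lattice M.L = lattice M'.L := by
    rw [hM.lattice_eq_translations, hM'.lattice_eq_translations, Crystal.translations_congr h]
  obtain ⟨e, he⟩ := Crystal.exists_equiv_of_infinite_eq h hL
  refine ⟨e, fun i => (he i).1, by simp only [rot_one, hL], fun i j => ?_⟩
  rw [rot_one, rot_one]
  exact sub_mem (he i).2 (he j).2

theorem unitCells_nonempty (Z : Feature d → ℕ) (r : ℝ) (M : Crystal d) :
    (unitCells Z r M).Nonempty := by
  obtain ⟨B, hB⟩ := exists_isNiggliBasis M.linInd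
  have : Nonempty (Fin M.n) := ⟨⟨0, M.n_pos⟩⟩
  obtain ⟨o, ho⟩ := Finite.exists_min (originKey Z r M B)
  exact ⟨_, B, o, ⟨hB, ho⟩, rfl⟩

end Mat2Seq

end

theorem lemma2 {d : ℕ} (Z : Mat2Seq.Feature d → ℕ) (r : ℝ) :
    -- the selection rules always admit a unit cell
    (∀ M : Mat2Seq.Crystal d, (Mat2Seq.unitCells Z r M).Nonempty) ∧
    -- the unit cell is periodic invariant and equivariant
    Mat2Seq.PeriodicInvariant (Mat2Seq.unitCells Z r) ∧
    (∀ (M : Mat2Seq.Crystal d) (R : Matrix.specialOrthogonalGroup (Fin 3) ℝ) (b : Mat2Seq.E3),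
      Mat2Seq.unitCells Z r (M.rigid R b) =
        Mat2Seq.UnitCell.rotate R '' Mat2Seq.unitCells Z r M) ∧
    -- the map to sequences is periodic invariant and unit cell SE(3) invariant
    (∀ τ : Set (List Mat2Seq.Token) → List Mat2Seq.Token, Mat2Seq.IsTieBreak τ →
      Mat2Seq.PeriodicInvariant (Mat2Seq.mat2Seq Z r τ) ∧
      Mat2Seq.UnitCellSE3Invariant (Mat2Seq.mat2Seq Z r τ)) ∧
    -- where the rules leave no tie, this holds for every map that follows the rules
    (∀ f : Mat2Seq.Crystal d → List Mat2Seq.Token,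
      (∀ M, f M ∈ Mat2Seq.admissibleSequences Z r M) →
      ∀ M : Mat2Seq.Crystal d, (Mat2Seq.admissibleSequences Z r M).Subsingleton →
        (∀ M' : Mat2Seq.Crystal d, M.IsMinimal → M'.IsMinimal → M.infinite = M'.infinite →
          f M = f M') ∧
        (∀ (R : Matrix.specialOrthogonalGroup (Fin 3) ℝ) (b : Mat2Seq.E3),
          f M = f (M.rigid R b))) := by
  have hper : Mat2Seq.PeriodicInvariant (Mat2Seq.admissibleSequences Z r) := by
    intro M M' hM hM' h
    obtain ⟨e, he⟩ := Mat2Seq.exists_isCongruence_one hM hM' h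
    exact (he.admissibleSequences_eq Z r).symm
  have hrig : Mat2Seq.UnitCellSE3Invariant (Mat2Seq.admissibleSequences Z r) := fun M R b =>
    ((Mat2Seq.isCongruence_rigid M R b).admissibleSequences_eq Z r).symm
  refine ⟨Mat2Seq.unitCells_nonempty Z r, ?_, ?_, fun τ _ => ⟨?_, ?_⟩, fun f hf M hM => ⟨?_, ?_⟩⟩
  · intro M M' hM hM' h
    obtain ⟨e, he⟩ := Mat2Seq.exists_isCongruence_one hM hM' h
    rw [he.unitCells_eq Z r]
    simp [Mat2Seq.rotate_one]
  · exact fun M R b => (Mat2Seq.isCongruence_rigid M R b).unitCells_eq Z r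
  · exact fun M M' hM hM' h => congrArg τ (hper M M' hM hM' h)
  · exact fun M R b => congrArg τ (hrig M R b)
  · intro M' h1 h2 h3
    -- Both values lie in the same set of admissible sequences, which has at most one element.
    exact hM (hf M) (hper M M' h1 h2 h3 ▸ hf M')
  · intro R b
    exact hM (hf M) (hrig M R b ▸ hf (M.rigid R b))
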